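/- **Theorem 1.1.** For a partition $\lambda$ let $m_i(\lambda)$ be the multiplicity of the part $i$, let $l(\lambda)$ be the number of (nonzero) parts, and let $\lambda_{\mathrm e}$ and $\lambda_{\mathrm o}$ be the partitions formed by the even parts and by the odd parts of $\lambda$. Let $$H_m(z;t)=\sum_{i=0}^m z^i\,\frac{(t^{m-i+1};t)_i}{(t;t)_i},\qquad (x;t)_k=\prod_{j=0}^{k-1}(1-xt^j),\qquad h_\lambda(z;t)=\prod_{i\ge1}H_{m_i(\lambda)}(z;t),$$ be the Rogers–Szegő polynomials and their extension to partitions. For $x=(x_1,\dots,x_n)$ and $l(\lambda)\le n$ let $$P_\lambda(x;t)=\sum_{w\in S_n/S_n^\lambda}w\Bigl(x^\lambda\prod_{\lambda_i>\lambda_j}\frac{x_i-tx_j}{x_i-x_j}\Bigr)$$ be the Hall–Littlewood polynomial, where $S_n^\lambda$ is the stabilizer of $\lambda=(\lambda_1,\dots,\lambda_n)$ in $S_n$, and let $P_\lambda(x;t)=0$ if $l(\lambda)>n$; since $P_\lambda(x_1,\dots,x_n,0;t)=P_\lambda(x_1,\dots,x_n;t)$, these polynomials define the Hall–Littlewood function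 $P_\lambda(x;t)$ in infinitely many variables $x=(x_1,x_2,\dots)$. Let $K$ be a field and let $a,b,t\in K$, where $a\ne0$ and $t^m\ne1$ for all $m\ge1$ (for example $K=\mathbb Q(a,b,t)$ with indeterminates $a,b,t$). Then, for $x=(x_1,\dots,x_n)$ with any $n\ge0$ and also for $x=(x_1,x_2,\dots)$, the following identity of formal power series in $x$ over $K$ holds, in which the sum, over all partitions $\lambda$, and the products converge coefficientwise: $$\sum_{\lambda}a^{l(\lambda_{\mathrm o})}\,h_{\lambda_{\mathrm e}}(ab;t)\,h_{\lambda_{\mathrm o}}(b/a;t)\,P_\lambda(x;t)=\prod_{i\ge1}\frac{(1+ax_i)(1+bx_i)}{(1-x_i)(1+x_i)}\;\prod_{i<j}\frac{1-tx_ix_j}{1-x_ix_j}.$$ -/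

import Mathlib

open scoped MvPowerSeries.WithPiTopology

namespace HallLittlewood

/-! Partitions -/

/-- The set of all partitions, of all weights. -/
abbrev Ptn : Type := Σ n : ℕ, Nat.Partition n

/-- The multiplicity `m_i(μ)` of the part `i` in `μ`. -/
def mult (μ : Ptn) (i : ℕ) : ℕ := μ.2.parts.count i

/-- The length `l(μ)`: the number of (nonzero) parts. -/
def len (μ : Ptn) : ℕ := μ.2.parts.card

/-- The partition formed by the even parts of `μ`. -/
def evenPart (μ : Ptn) : Ptn := ⟨_, Nat.Partition.ofMultiset (μ.2.parts.filter fun i => Even i)⟩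

/-- The partition formed by the odd parts of `μ`. -/
def oddPart (μ : Ptn) : Ptn := ⟨_, Nat.Partition.ofMultiset (μ.2.parts.filter fun i => Odd i)⟩

/-- `μ` written as a weakly decreasing sequence followed by zeros, cut off after `n` entries
(the entries are indexed from `0`). -/
def seq (n : ℕ) (μ : Ptn) : Fin n → ℕ := fun i => (μ.2.parts.sort (· ≥ ·)).getD i 0

/-! Rogers–Szegő polynomials -/

section RogersSzego

variable {K : Type*} [Field K]

/-- The shifted factorial `(x;t)_n = (1 - x) (1 - x t) ⋯ (1 - x t ^ (n - 1))`. -/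
def shiftedFactorial (x t : K) (n : ℕ) : K := ∏ k ∈ Finset.range n, (1 - x * t ^ k)

/-- The `t`-binomial coefficient `(t ^ (n - m + 1); t)_m / (t; t)_m`, which is `0` for `m > n`. -/
def tBinom (t : K) (n m : ℕ) : K :=
  if m ≤ n then shiftedFactorial (t ^ (n - m + 1)) t m / shiftedFactorial t t m else 0

/-- The Rogers–Szegő polynomial `H_m(z;t)`. -/
def rogersSzego (m : ℕ) (z t : K) : K := ∑ i ∈ Finset.range (m + 1), z ^ i * tBinom t m i

/-- `h_μ(z;t) = ∏_{i ≥ 1} H_{m_i(μ)}(z;t)`; the factors with `m_i(μ) = 0` are equal to `1`. -/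
def hPtn (μ : Ptn) (z t : K) : K := ∏ i ∈ μ.2.parts.toFinset, rogersSzego (mult μ i) z t

end RogersSzego

/-! Hall–Littlewood polynomials -/

section Polynomials

variable {K : Type*} [Field K] {n : ℕ}

/-- The variable `x_i` in the field of rational functions in `n` variables. -/
noncomputable def xvar (K : Type*) [Field K] {n : ℕ} (i : Fin n) :
    FractionRing (MvPolynomial (Fin n) K) :=
  algebraMap (MvPolynomial (Fin n) K) _ (MvPolynomial.X i)

/-- The scalar `t` in the field of rational functions in `n` variables. -/
noncomputable def scal (n : ℕ) (t : K) : FractionRing (MvPolynomial (Fin n) K) :=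
  algebraMap (MvPolynomial (Fin n) K) _ (MvPolynomial.C t)

/-- The subgroup of those permutations that leave the sequence `v` invariant. -/
def stab (v : Fin n → ℕ) : Subgroup (Equiv.Perm (Fin n)) where
  carrier := {w | ∀ i, v (w i) = v i}
  one_mem' := fun _ => rfl
  mul_mem' := fun {w u} hw hu i => by
    rw [Equiv.Perm.mul_apply, hw, hu]
  inv_mem' := fun {w} hw i => by
    have := hw (w⁻¹ i)
    simpa using this.symm

/-- The rational function
`w (x ^ v * ∏_{v_i > v_j} (x_i - t x_j) / (x_i - x_j))`, where `w` sends `x_i` to `x_{w i}`. -/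
noncomputable def hlTerm (t : K) (v : Fin n → ℕ) (w : Equiv.Perm (Fin n)) :
    FractionRing (MvPolynomial (Fin n) K) :=
  (∏ i, xvar K (w i) ^ v i) *
    ∏ p : Fin n × Fin n with v p.1 > v p.2,
      (xvar K (w p.1) - scal n t * xvar K (w p.2)) / (xvar K (w p.1) - xvar K (w p.2))

lemma hlTerm_eq (t : K) (v : Fin n → ℕ) (w : Equiv.Perm (Fin n)) :
    hlTerm t v w = hlTerm t (fun i => v (w⁻¹ i)) 1 := by
  unfold hlTerm
  congr 1
  · exact Fintype.prod_equiv w _ _ (fun i => by simp)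
  · rw [Finset.prod_filter, Finset.prod_filter]
    exact Fintype.prod_equiv (Equiv.prodCongr w w) _ _ (fun p => by simp)

lemma hlTerm_congr (t : K) (v : Fin n → ℕ) (w u : Equiv.Perm (Fin n))
    (h : w⁻¹ * u ∈ stab v) : hlTerm t v w = hlTerm t v u := by
  rw [hlTerm_eq t v w, hlTerm_eq t v u]
  congr 1
  funext i
  have := h (u⁻¹ i)
  simpa using this

/-- The sum of `w (x ^ v * ∏_{v_i > v_j} (x_i - t x_j) / (x_i - x_j))` over the cosets `w` of
the stabilizer of `v` in the symmetric group, as a rational function. -/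
noncomputable def hlRational (t : K) (v : Fin n → ℕ) : FractionRing (MvPolynomial (Fin n) K) :=
  ∑ᶠ q : Equiv.Perm (Fin n) ⧸ stab v,
    Quotient.liftOn' q (hlTerm t v) fun w u h =>
      hlTerm_congr t v w u (QuotientGroup.leftRel_apply.mp h)

/-! The next lemmas show that this rational function is a polynomial. -/

/-- The substitution `x_i ↦ x_j`. -/
noncomputable def collapse (K : Type*) [Field K] {n : ℕ} (i j : Fin n) :
    MvPolynomial (Fin n) K →ₐ[K] MvPolynomial (Fin n) K :=
  MvPolynomial.rename (fun k => if k = i then j else k)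

lemma dvd_sub_collapse (i j : Fin n) (p : MvPolynomial (Fin n) K) :
    (MvPolynomial.X i - MvPolynomial.X j) ∣ p - collapse K i j p := by
  induction p using MvPolynomial.induction_on with
  | C a => simp [collapse]
  | add p q hp hq =>
    rw [map_add, add_sub_add_comm]
    exact dvd_add hp hq
  | mul_X p k hp =>
    have hk : (MvPolynomial.X i - MvPolynomial.X j : MvPolynomial (Fin n) K) ∣
        MvPolynomial.X k - collapse K i j (MvPolynomial.X k) := by
      by_cases h : k = i
      · simp [collapse, h]
      · simp [collapse, h]
    rw [map_mul]
    have : p * MvPolynomial.X k - collapse K i j p * collapse K i j (MvPolynomial.X k)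
        = (p - collapse K i j p) * MvPolynomial.X k +
          collapse K i j p * (MvPolynomial.X k - collapse K i j (MvPolynomial.X k)) := by ring
    rw [this]
    exact dvd_add (hp.mul_right _) (hk.mul_left _)

lemma dvd_iff_collapse (i j : Fin n) (p : MvPolynomial (Fin n) K) :
    (MvPolynomial.X i - MvPolynomial.X j) ∣ p ↔ collapse K i j p = 0 := by
  constructor
  · rintro ⟨q, rfl⟩
    rw [map_mul, map_sub]
    by_cases h : j = i <;> simp [collapse, h]
  · intro h
    simpa [h] using dvd_sub_collapse i j p

lemma X_sub_ne_zero {i j : Fin n} (h : i ≠ j) :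
    (MvPolynomial.X i - MvPolynomial.X j : MvPolynomial (Fin n) K) ≠ 0 :=
  sub_ne_zero.mpr fun e => h (MvPolynomial.X_injective e)

lemma prime_X_sub {i j : Fin n} (h : i ≠ j) :
    Prime (MvPolynomial.X i - MvPolynomial.X j : MvPolynomial (Fin n) K) := by
  refine ⟨X_sub_ne_zero h, ?_, ?_⟩
  · intro hu
    have := (dvd_iff_collapse i j (1 : MvPolynomial (Fin n) K)).mp hu.dvd
    simp at this
  · intro p q
    simp only [dvd_iff_collapse, map_mul, mul_eq_zero, imp_self]

/-- The ordered pairs of distinct indices other than `(i, j)` and `(j, i)`. -/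
def otherPairs (i j : Fin n) : Finset (Fin n × Fin n) :=
  Finset.univ.filter fun p => p.1 ≠ p.2 ∧ p ≠ (i, j) ∧ p ≠ (j, i)

/-- The product of `x_k - x_l` over a set of pairs `(k, l)`. -/
noncomputable def diffProd (K : Type*) [Field K] {n : ℕ} (s : Finset (Fin n × Fin n)) :
    MvPolynomial (Fin n) K :=
  ∏ p ∈ s, (MvPolynomial.X p.1 - MvPolynomial.X p.2)

lemma not_dvd_diffProd {i j : Fin n} (_h : i ≠ j) :
    ¬ (MvPolynomial.X i - MvPolynomial.X j) ∣ diffProd K (otherPairs i j) := by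
  rw [dvd_iff_collapse, diffProd, map_prod, Finset.prod_eq_zero_iff]
  rintro ⟨⟨k, l⟩, hp, h0⟩
  simp only [otherPairs, Finset.mem_filter, Finset.mem_univ, true_and, ne_eq, Prod.mk.injEq]
    at hp
  obtain ⟨h1, h2, h3⟩ := hp
  rw [map_sub, sub_eq_zero] at h0
  simp only [collapse, MvPolynomial.rename_X] at h0
  have := MvPolynomial.X_injective h0
  grind

lemma diffProd_ne_zero {s : Finset (Fin n × Fin n)} (hs : ∀ p ∈ s, p.1 ≠ p.2) :
    diffProd K s ≠ 0 :=
  Finset.prod_ne_zero_iff.mpr fun p hp => X_sub_ne_zero (hs p hp)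

lemma mem_range_of_local (f : FractionRing (MvPolynomial (Fin n) K))
    (W : ∃ N, algebraMap (MvPolynomial (Fin n) K) _ N =
      algebraMap _ _ (diffProd K (Finset.univ.filter fun p : Fin n × Fin n => p.1 ≠ p.2)) * f)
    (S : ∀ i j : Fin n, i ≠ j → ∃ N, algebraMap (MvPolynomial (Fin n) K) _ N =
      algebraMap _ _ (diffProd K (otherPairs i j)) * f) :
    ∃ N, algebraMap (MvPolynomial (Fin n) K) _ N = f := by
  obtain ⟨x, y, hxy, hf⟩ :=
    IsFractionRing.exists_reduced_fraction (A := MvPolynomial (Fin n) K) f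
  have hy : algebraMap (MvPolynomial (Fin n) K)
      (FractionRing (MvPolynomial (Fin n) K)) y ≠ 0 :=
    IsFractionRing.to_map_ne_zero_of_mem_nonZeroDivisors y.2
  have key : ∀ s : MvPolynomial (Fin n) K,
      (∃ N, algebraMap (MvPolynomial (Fin n) K) _ N = algebraMap _ _ s * f) →
      (y : MvPolynomial (Fin n) K) ∣ s := by
    rintro s ⟨N, hN⟩
    rw [← hf, IsFractionRing.mk'_eq_div, ← mul_div_assoc, eq_div_iff hy, ← map_mul, ← map_mul]
      at hN
    have hN' := IsFractionRing.injective (MvPolynomial (Fin n) K) _ hN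
    have hd : (y : MvPolynomial (Fin n) K) ∣ s * x := ⟨N, by rw [← hN', mul_comm]⟩
    exact hxy.symm.dvd_of_dvd_mul_right hd
  have hu : IsUnit (y : MvPolynomial (Fin n) K) := by
    by_contra hu
    obtain ⟨p, hp, hpy⟩ :=
      WfDvdMonoid.exists_irreducible_factor hu (nonZeroDivisors.ne_zero y.2)
    obtain ⟨⟨i, j⟩, hij, hd⟩ := hp.prime.exists_mem_finset_dvd (hpy.trans (key _ W))
    simp only [Finset.mem_filter, Finset.mem_univ, true_and] at hij
    have ha := hp.prime.associated_of_dvd (prime_X_sub hij) hd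
    exact not_dvd_diffProd hij (ha.symm.dvd.trans (hpy.trans (key _ (S i j hij))))
  obtain ⟨z, hz⟩ := hu.exists_right_inv
  refine ⟨x * z, ?_⟩
  rw [← hf, IsFractionRing.mk'_eq_div, eq_div_iff hy, ← map_mul, mul_assoc, mul_comm z, hz,
    mul_one]

lemma xvar_sub_ne_zero {i j : Fin n} (h : i ≠ j) : xvar K i - xvar K j ≠ 0 := by
  unfold xvar
  rw [← map_sub]
  exact fun e => X_sub_ne_zero h
    (IsFractionRing.injective (MvPolynomial (Fin n) K) _ (by rw [e, map_zero]))

/-- A polynomial divisible by the denominator clears it. -/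
lemma hlTerm_clear (t : K) (α : Fin n → ℕ) (s : MvPolynomial (Fin n) K)
    (hs : diffProd K (Finset.univ.filter fun p : Fin n × Fin n => α p.1 > α p.2) ∣ s) :
    ∃ N, algebraMap (MvPolynomial (Fin n) K) _ N = algebraMap _ _ s * hlTerm t α 1 := by
  obtain ⟨c, rfl⟩ := hs
  refine ⟨c * ((∏ i, MvPolynomial.X i ^ α i) *
    ∏ p : Fin n × Fin n with α p.1 > α p.2,
      (MvPolynomial.X p.1 - MvPolynomial.C t * MvPolynomial.X p.2)), ?_⟩
  have hD : algebraMap (MvPolynomial (Fin n) K) (FractionRing (MvPolynomial (Fin n) K))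
      (diffProd K (Finset.univ.filter fun p : Fin n × Fin n => α p.1 > α p.2)) ≠ 0 := by
    intro e
    refine diffProd_ne_zero (K := K)
      (s := Finset.univ.filter fun p : Fin n × Fin n => α p.1 > α p.2) ?_
      (IsFractionRing.injective (MvPolynomial (Fin n) K) _ (by rw [e, map_zero]))
    intro p hp e
    simp [e] at hp
  unfold hlTerm
  rw [Finset.prod_div_distrib]
  simp only [Equiv.Perm.coe_one, id_eq]
  have hD2 : (∏ p : Fin n × Fin n with α p.1 > α p.2, (xvar K p.1 - xvar K p.2)) =
      algebraMap (MvPolynomial (Fin n) K) (FractionRing (MvPolynomial (Fin n) K))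
      (diffProd K (Finset.univ.filter fun p : Fin n × Fin n => α p.1 > α p.2)) := by
    simp [diffProd, xvar, map_prod]
  rw [hD2]
  simp only [map_mul, map_prod, map_pow, map_sub, xvar, scal]
  field_simp

lemma denom_dvd (α : Fin n → ℕ) (i j : Fin n) :
    diffProd K (Finset.univ.filter fun p : Fin n × Fin n => α p.1 > α p.2) ∣
      diffProd K (otherPairs i j) * (MvPolynomial.X i - MvPolynomial.X j) := by
  classical
  set A := Finset.univ.filter fun p : Fin n × Fin n => α p.1 > α p.2 with hA
  have h1 : diffProd K (A.filter fun p => p ≠ (i, j) ∧ p ≠ (j, i)) ∣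
      diffProd K (otherPairs i j) := by
    apply Finset.prod_dvd_prod_of_subset
    intro p hp
    simp only [hA, otherPairs, Finset.mem_filter, Finset.mem_univ, true_and] at hp ⊢
    exact ⟨fun e => by simp [e] at hp, hp.2⟩
  have h2 : diffProd K (A.filter fun p => ¬ (p ≠ (i, j) ∧ p ≠ (j, i))) ∣
      (MvPolynomial.X i - MvPolynomial.X j) := by
    have hsub : (A.filter fun p => ¬ (p ≠ (i, j) ∧ p ≠ (j, i))) ⊆ {(i, j)} ∨
        (A.filter fun p => ¬ (p ≠ (i, j) ∧ p ≠ (j, i))) ⊆ {(j, i)} := by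
      rcases le_total (α i) (α j) with h | h
      · right
        intro p hp
        simp only [hA, Finset.mem_filter, Finset.mem_univ, true_and] at hp
        grind
      · left
        intro p hp
        simp only [hA, Finset.mem_filter, Finset.mem_univ, true_and] at hp
        grind
    rcases hsub with h | h
    · refine (Finset.prod_dvd_prod_of_subset _ _ _ h).trans ?_
      simp
    · refine (Finset.prod_dvd_prod_of_subset _ _ _ h).trans ?_
      rw [Finset.prod_singleton, ← neg_sub, neg_dvd]
  have := mul_dvd_mul h1 h2
  rwa [diffProd, diffProd, Finset.prod_filter_mul_prod_filter_not] at this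

lemma denom_dvd_of_eq (α : Fin n → ℕ) (i j : Fin n) (h : α i = α j) :
    diffProd K (Finset.univ.filter fun p : Fin n × Fin n => α p.1 > α p.2) ∣
      diffProd K (otherPairs i j) := by
  apply Finset.prod_dvd_prod_of_subset
  intro p hp
  simp only [otherPairs, Finset.mem_filter, Finset.mem_univ, true_and] at hp ⊢
  grind

/-- Numerators of the terms belonging to `α` and to `α` with two entries exchanged. -/
lemma numer_swap (t : K) (α : Fin n → ℕ) (i j : Fin n) (N M : MvPolynomial (Fin n) K)
    (hN : algebraMap (MvPolynomial (Fin n) K) _ N = algebraMap _ _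
      (diffProd K (otherPairs i j) * (MvPolynomial.X i - MvPolynomial.X j)) * hlTerm t α 1)
    (hM : algebraMap (MvPolynomial (Fin n) K) _ M = algebraMap _ _
      (diffProd K (otherPairs i j) * (MvPolynomial.X i - MvPolynomial.X j)) *
        hlTerm t (fun k => α (Equiv.swap i j k)) 1) :
    collapse K i j N + collapse K i j M = 0 := by
  let σ : MvPolynomial (Fin n) K ≃+* MvPolynomial (Fin n) K :=
    (MvPolynomial.renameEquiv K (Equiv.swap i j)).toRingEquiv
  let τ : FractionRing (MvPolynomial (Fin n) K) ≃+* FractionRing (MvPolynomial (Fin n) K) :=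
    IsFractionRing.ringEquivOfRingEquiv σ
  have hτ : ∀ p, τ (algebraMap (MvPolynomial (Fin n) K) _ p) = algebraMap _ _ (σ p) :=
    fun p => IsFractionRing.ringEquivOfRingEquiv_algebraMap σ p
  have hσX : ∀ k, σ (MvPolynomial.X k) = MvPolynomial.X (Equiv.swap i j k) :=
    fun k => by simp [σ]
  have hσC : σ (MvPolynomial.C t) = MvPolynomial.C t := by simp [σ]
  have hx : ∀ k, τ (xvar K k) = xvar K (Equiv.swap i j k) := fun k => by
    rw [xvar, hτ, hσX, xvar]
  have hc : τ (scal n t) = scal n t := by rw [scal, hτ, hσC]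
  have h1 : τ (hlTerm t α 1) = hlTerm t (fun k => α (Equiv.swap i j k)) 1 := by
    have e := hlTerm_eq t α (Equiv.swap i j)
    rw [Equiv.swap_inv] at e
    rw [← e]
    simp only [hlTerm, map_mul, map_prod, map_pow, map_div₀, map_sub, hx, hc,
      Equiv.Perm.coe_one, id_eq]
  have h2 : σ (diffProd K (otherPairs i j)) = diffProd K (otherPairs i j) := by
    unfold diffProd
    rw [map_prod]
    refine Finset.prod_equiv (Equiv.prodCongr (Equiv.swap i j) (Equiv.swap i j)) ?_ ?_
    · rintro ⟨k, l⟩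
      simp only [otherPairs, Finset.mem_filter, Finset.mem_univ, true_and,
        Equiv.prodCongr_apply, Prod.map, ne_eq, Prod.mk.injEq, EmbeddingLike.apply_eq_iff_eq]
      have e1 : ∀ k, Equiv.swap i j k = i ↔ k = j := fun k => by
        rw [Equiv.swap_apply_eq_iff, Equiv.swap_apply_left]
      have e2 : ∀ k, Equiv.swap i j k = j ↔ k = i := fun k => by
        rw [Equiv.swap_apply_eq_iff, Equiv.swap_apply_right]
      simp only [e1, e2]
      tauto
    · rintro ⟨k, l⟩ _
      simp [hσX]
  have h3 : M = - σ N := by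
    apply IsFractionRing.injective (MvPolynomial (Fin n) K)
      (FractionRing (MvPolynomial (Fin n) K))
    rw [map_neg, ← hτ, hN, map_mul, hτ, h1, hM, map_mul σ, h2, map_sub, hσX, hσX,
      Equiv.swap_apply_left, Equiv.swap_apply_right]
    simp only [map_mul, map_sub]
    ring
  have h4 : collapse K i j (σ N) = collapse K i j N := by
    have : σ N = MvPolynomial.rename (Equiv.swap i j) N := by simp [σ]
    rw [this, collapse, MvPolynomial.rename_rename]
    congr 2
    funext k
    simp only [Function.comp]
    rcases eq_or_ne k i with rfl | h
    · simp
    · rcases eq_or_ne k j with rfl | h'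
      · simp
      · rw [Equiv.swap_apply_of_ne_of_ne h h']
  rw [h3, map_neg, h4, add_neg_cancel]

/-- The sequence `w v` for a coset `w`. -/
def orbitSeq (v : Fin n → ℕ) (q : Equiv.Perm (Fin n) ⧸ stab v) : Fin n → ℕ :=
  Quotient.liftOn' q (fun w i => v (w⁻¹ i)) fun w u h => by
    funext i
    have := (QuotientGroup.leftRel_apply.mp h) (u⁻¹ i)
    simpa using this

lemma hlRational_eq (t : K) (v : Fin n → ℕ) [Fintype (Equiv.Perm (Fin n) ⧸ stab v)] :
    hlRational t v = ∑ q : Equiv.Perm (Fin n) ⧸ stab v, hlTerm t (orbitSeq v q) 1 := by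
  unfold hlRational
  rw [finsum_eq_sum_of_fintype]
  refine Finset.sum_congr rfl fun q _ => ?_
  induction q using Quotient.inductionOn' with
  | h w => exact hlTerm_eq t v w

theorem exists_hlPoly (t : K) (v : Fin n → ℕ) :
    ∃ N, algebraMap (MvPolynomial (Fin n) K) _ N = hlRational t v := by
  classical
  have : Fintype (Equiv.Perm (Fin n) ⧸ stab v) := Fintype.ofFinite _
  rw [hlRational_eq]
  apply mem_range_of_local
  · have : ∀ q : Equiv.Perm (Fin n) ⧸ stab v, ∃ N, algebraMap (MvPolynomial (Fin n) K) _ N =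
        algebraMap _ _ (diffProd K (Finset.univ.filter fun p : Fin n × Fin n => p.1 ≠ p.2)) *
          hlTerm t (orbitSeq v q) 1 := fun q => by
      apply hlTerm_clear
      apply Finset.prod_dvd_prod_of_subset
      intro p hp
      simp only [Finset.mem_filter, Finset.mem_univ, true_and] at hp ⊢
      exact fun e => by simp [e] at hp
    choose N hN using this
    exact ⟨∑ q, N q, by rw [map_sum, Finset.mul_sum]; exact Finset.sum_congr rfl fun q _ => hN q⟩
  · intro i j hij
    have : ∀ q : Equiv.Perm (Fin n) ⧸ stab v, ∃ N, algebraMap (MvPolynomial (Fin n) K) _ N =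
        algebraMap _ _ (diffProd K (otherPairs i j) * (MvPolynomial.X i - MvPolynomial.X j)) *
          hlTerm t (orbitSeq v q) 1 := fun q =>
      hlTerm_clear t _ _ (denom_dvd _ i j)
    choose N hN using this
    have horb : ∀ q : Equiv.Perm (Fin n) ⧸ stab v,
        orbitSeq v (Equiv.swap i j • q) = fun k => orbitSeq v q (Equiv.swap i j k) := by
      intro q
      induction q using Quotient.inductionOn' with
      | h w =>
        funext k
        change v ((Equiv.swap i j * w)⁻¹ k) = v (w⁻¹ (Equiv.swap i j k))
        simp [mul_inv_rev]
    have hfix : ∀ q : Equiv.Perm (Fin n) ⧸ stab v, Equiv.swap i j • q = q →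
        orbitSeq v q i = orbitSeq v q j := by
      intro q hq
      have := congrFun (horb q) i
      rwa [hq, Equiv.swap_apply_left] at this
    have hsum : collapse K i j (∑ q, N q) = 0 := by
      rw [map_sum]
      refine Finset.sum_involution (fun q _ => Equiv.swap i j • q) ?_ ?_ ?_ ?_
      · intro q _
        refine numer_swap t (orbitSeq v q) i j _ _ (hN q) ?_
        rw [← horb q]
        exact hN _
      · intro q _ hne hq
        apply hne
        rw [← dvd_iff_collapse]
        obtain ⟨M, hM⟩ := hlTerm_clear t _ _ (denom_dvd_of_eq (K := K) _ i j (hfix q hq))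
        refine ⟨M, IsFractionRing.injective (MvPolynomial (Fin n) K)
          (FractionRing (MvPolynomial (Fin n) K)) ?_⟩
        rw [hN, map_mul, map_mul, hM]
        ring
      · intro q _
        exact Finset.mem_univ _
      · intro q _
        rw [smul_smul, Equiv.swap_mul_self, one_smul]
    obtain ⟨M, hM⟩ := (dvd_iff_collapse i j _).mpr hsum
    refine ⟨M, ?_⟩
    have hx : algebraMap (MvPolynomial (Fin n) K) (FractionRing (MvPolynomial (Fin n) K))
        (MvPolynomial.X i - MvPolynomial.X j) ≠ 0 := by
      rw [map_sub]
      exact xvar_sub_ne_zero hij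
    apply mul_left_cancel₀ hx
    rw [← map_mul, ← hM, map_sum, ← mul_assoc, ← map_mul, Finset.mul_sum]
    refine Finset.sum_congr rfl fun q _ => ?_
    rw [hN, mul_comm (MvPolynomial.X i - MvPolynomial.X j)]

/-- The Hall–Littlewood polynomial `P_μ(x_1, …, x_n; t)`: the polynomial equal to the coset sum
`hlRational` if `l(μ) ≤ n`, and `0` if `l(μ) > n`. -/
noncomputable def hlPoly (n : ℕ) (t : K) (μ : Ptn) : MvPolynomial (Fin n) K :=
  if len μ ≤ n then (exists_hlPoly t (seq n μ)).choose else 0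

lemma algebraMap_hlPoly (n : ℕ) (t : K) (μ : Ptn) (h : len μ ≤ n) :
    algebraMap _ (FractionRing (MvPolynomial (Fin n) K)) (hlPoly n t μ) =
      hlRational t (seq n μ) := by
  rw [hlPoly, if_pos h]
  exact (exists_hlPoly t (seq n μ)).choose_spec

/-- The Hall–Littlewood function `P_μ(x_0, x_1, x_2, …; t)` in infinitely many variables, as a
formal power series. The coefficient of a monomial that involves only `x_0, …, x_{n-1}` is its
coefficient in `P_μ(x_0, …, x_{n-1}; t)`; because
`P_μ(x_0, …, x_{n-1}, 0; t) = P_μ(x_0, …, x_{n-1}; t)`, any such `n` gives the same value, and the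
least one is taken. -/
noncomputable def hlFun (t : K) (μ : Ptn) : MvPowerSeries ℕ K := fun d =>
  let n := d.support.sup (fun i => i + 1)
  (hlPoly n t μ).coeff (d.comapDomain (fun i : Fin n => (i : ℕ)) Fin.val_injective.injOn)

end Polynomials

/-! The two kinds of factors of the product side -/

section Factors

variable {K : Type*} [Field K] {σ : Type*}

/-- The series `(1 + a x_i) (1 + b x_i) / ((1 - x_i) (1 + x_i))`. -/
noncomputable def singleFactor (a b : K) (i : σ) : MvPowerSeries σ K :=
  (1 + MvPowerSeries.C a * MvPowerSeries.X i) * (1 + MvPowerSeries.C b * MvPowerSeries.X i) *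
    ((1 - MvPowerSeries.X i) * (1 + MvPowerSeries.X i))⁻¹

/-- The series `(1 - t x_i x_j) / (1 - x_i x_j)`. -/
noncomputable def pairFactor (t : K) (i j : σ) : MvPowerSeries σ K :=
  (1 - MvPowerSeries.C t * MvPowerSeries.X i * MvPowerSeries.X j) *
    (1 - MvPowerSeries.X i * MvPowerSeries.X j)⁻¹

end Factors

end HallLittlewood

/-!
For an exponent sequence `f : Fin n → ℕ` put
`T f = x ^ f * ∏_{f_i > f_j} (x_i - t x_j) / (x_i - x_j)`. The Hall–Littlewood polynomial `P_μ` is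
the sum of `T f` over the `f` whose nonzero entries form `μ`, so the sum side is a sum over all
exponent sequences, in which `f` has a weight that is a product over the blocks of equal entries:
`H_m(ab)` for a block of a positive even value, `a ^ m H_m(b/a)` for a block of an odd value, `1`
for the zeros. In order that infinite sums of rational functions make sense, `x_i` is replaced by
`X * x_i` in the power series in `X` over the field of rational functions (`gradedEmbedding`).

All variables are treated together with their subsets: a series is a function of a finite set `Y`
of variables. Splitting off the zeros of `f` (`exponentSeries_recursion`) expresses the series of
`Y` by those of the subsets of `Y`, with the entries lowered by `1`. In terms of the operators
`C_w = splitOff w` (split off a block, with a weight depending on its size),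
`C_p = C_{m ↦ p ^ m}`, `D = mulVars` (multiply by all variables) and `M_b = mulElem b` (multiply
by all `1 + b x_i`) the proof rests on three facts.

* `C_p C_q = C_w`, where `w m` is the homogeneous Rogers–Szegő polynomial of degree `m` at
  `(p, q)` (`splitOff_splitOff`). This is the symmetrization of a constant,
  `sum_crossProd_eq_homRS`.
* `M_b C_p D = C_p D C_{pb} M_b` (`mulElem_splitOff_mulVars`), a form of the Pieri formula. It
  follows from `P_{(1^r)} = e_r`, that is `sum_crossProd_eq_prod_one_add`.
* `L = ∏ 1 / (1 - x_i) * ∏_{i < j} (1 - t x_i x_j) / (1 - x_i x_j)` satisfies `L = C_1 D L`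
  (`littlewood_recursion`), which is Littlewood's identity for the sum of all `P_μ`. The
  underlying rational identity is `sum_littlewoodWeight`.

The three rational identities are proved by induction on the number of variables: as a function of
one of the values each sum is a polynomial, because the residues cancel
(`exists_polynomial_of_subset_sum`), and it is determined by few of its values.

Let `M_1 E = L`. The Pieri formula gives `M_1 C_1 D D E = C_1 D C_1 D L = L`, so `E = C_1 D D E`:
`E` is the sum over the partitions with even parts. Two further applications show that
`M_a M_b E`, which is the product side, satisfies `W = C_1 D C_a C_b D C_{ab} W`. The sum side
satisfies the same recursion, which has only one solution with `W ∅ = 1` since `D` raises the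
degree (`recursion_solution`).

The identity in infinitely many variables follows coefficient by coefficient, by setting all but
finitely many variables equal to `0`.
-/

namespace HallLittlewood

/-! ### Gaussian binomial coefficients -/

section GaussianBinomial

variable {F : Type*} [Field F]

lemma shiftedFactorial_succ (x t : F) (n : ℕ) :
    shiftedFactorial x t (n + 1) = shiftedFactorial x t n * (1 - x * t ^ n) := by
  simp [shiftedFactorial, Finset.prod_range_succ]

lemma shiftedFactorial_self_ne_zero {t : F} (ht : ∀ m : ℕ, 0 < m → t ^ m ≠ 1) (n : ℕ) :
    shiftedFactorial t t n ≠ 0 := by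
  refine Finset.prod_ne_zero_iff.mpr fun k _ h => ht (k + 1) k.succ_pos ?_
  rw [pow_succ']
  exact (sub_eq_zero.mp h).symm

lemma shiftedFactorial_self_add (t : F) (n m : ℕ) :
    shiftedFactorial t t (n + m) = shiftedFactorial t t n * shiftedFactorial (t ^ (n + 1)) t m := by
  simp only [shiftedFactorial, Finset.prod_range_add]
  congr 1
  refine Finset.prod_congr rfl fun k _ => ?_
  ring

/-- The Gaussian binomial coefficient in its symmetric form. -/
lemma tBinom_add {t : F} (ht : ∀ m : ℕ, 0 < m → t ^ m ≠ 1) (r s : ℕ) :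
    tBinom t (r + s) r =
      shiftedFactorial t t (r + s) / (shiftedFactorial t t r * shiftedFactorial t t s) := by
  have hr := shiftedFactorial_self_ne_zero ht r
  have hs := shiftedFactorial_self_ne_zero ht s
  rw [tBinom, if_pos (Nat.le_add_right r s), Nat.add_sub_cancel_left, Nat.add_comm r s,
    shiftedFactorial_self_add]
  field_simp

lemma tBinom_symm {t : F} (ht : ∀ m : ℕ, 0 < m → t ^ m ≠ 1) {r m : ℕ} (h : r ≤ m) :
    tBinom t m (m - r) = tBinom t m r := by
  obtain ⟨s, rfl⟩ := Nat.exists_eq_add_of_le h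
  rw [Nat.add_sub_cancel_left, tBinom_add ht, Nat.add_comm r s, tBinom_add ht, mul_comm]

lemma tBinom_zero_right (t : F) (m : ℕ) : tBinom t m 0 = 1 := by
  simp [tBinom, shiftedFactorial]

lemma tBinom_self {t : F} (ht : ∀ m : ℕ, 0 < m → t ^ m ≠ 1) (m : ℕ) : tBinom t m m = 1 := by
  rw [← tBinom_symm ht le_rfl, Nat.sub_self, tBinom_zero_right]

lemma tBinom_of_lt (t : F) {m r : ℕ} (h : m < r) : tBinom t m r = 0 := by
  rw [tBinom, if_neg (Nat.not_le.mpr h)]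

/-- Pascal's rule for Gaussian binomial coefficients. -/
lemma tBinom_succ_succ {t : F} (ht : ∀ m : ℕ, 0 < m → t ^ m ≠ 1) (m r : ℕ) :
    tBinom t (m + 1) (r + 1) = t ^ (m - r) * tBinom t m r + tBinom t m (r + 1) := by
  rcases lt_trichotomy m r with h | rfl | h
  · rw [tBinom_of_lt t h, tBinom_of_lt t (by omega), tBinom_of_lt t (by omega)]
    ring
  · rw [tBinom_self ht, tBinom_self ht, tBinom_of_lt t (by omega)]
    simp
  · obtain ⟨s, rfl⟩ : ∃ s, m = r + 1 + s := Nat.exists_eq_add_of_le h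
    have e1 : r + 1 + s + 1 = (r + 1) + (s + 1) := by ring
    have e2 : r + 1 + s = r + (s + 1) := by ring
    have e3 : tBinom t (r + 1 + s) r = tBinom t (r + (s + 1)) r := by rw [e2]
    have e4 : r + 1 + s - r = s + 1 := by omega
    rw [e1, tBinom_add ht, e3, tBinom_add ht, tBinom_add ht, e4,
      show r + 1 + (s + 1) = r + 1 + s + 1 by ring, show r + (s + 1) = r + 1 + s by ring,
      shiftedFactorial_succ _ _ (r + 1 + s), shiftedFactorial_succ _ _ r,
      shiftedFactorial_succ _ _ s]
    have h1 := shiftedFactorial_self_ne_zero ht r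
    have h2 := shiftedFactorial_self_ne_zero ht s
    have h3 : 1 - t * t ^ r ≠ 0 := fun h => ht (r + 1) r.succ_pos (by
      rw [pow_succ']; exact (sub_eq_zero.mp h).symm)
    have h4 : 1 - t * t ^ s ≠ 0 := fun h => ht (s + 1) s.succ_pos (by
      rw [pow_succ']; exact (sub_eq_zero.mp h).symm)
    field_simp
    ring

/-- The homogeneous Rogers–Szegő polynomial `∑_r q ^ r p ^ (m - r) [m, r]_t`. -/
noncomputable def homRS (t : F) (m : ℕ) (p q : F) : F :=
  ∑ r ∈ Finset.range (m + 1), q ^ r * p ^ (m - r) * tBinom t m r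

lemma homRS_zero (t p q : F) : homRS t 0 p q = 1 := by
  simp [homRS, tBinom_zero_right]

lemma homRS_comm {t : F} (ht : ∀ m : ℕ, 0 < m → t ^ m ≠ 1) (m : ℕ) (p q : F) :
    homRS t m p q = homRS t m q p := by
  unfold homRS
  rw [← Finset.sum_range_reflect]
  refine Finset.sum_congr rfl fun r hr => ?_
  have hr' : r ≤ m := Nat.lt_succ_iff.mp (Finset.mem_range.mp hr)
  rw [show m + 1 - 1 - r = m - r by omega, tBinom_symm ht hr', Nat.sub_sub_self hr']
  ring

lemma homRS_succ {t : F} (ht : ∀ m : ℕ, 0 < m → t ^ m ≠ 1) (m : ℕ) (p q : F) :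
    homRS t (m + 1) p q = q * homRS t m (t * p) q + p * homRS t m p q := by
  have h1 : homRS t (m + 1) p q = p ^ (m + 1) + ∑ r ∈ Finset.range (m + 1),
      q ^ (r + 1) * p ^ (m - r) * (t ^ (m - r) * tBinom t m r + tBinom t m (r + 1)) := by
    rw [homRS, Finset.sum_range_succ', add_comm]
    congr 1
    · simp [tBinom_zero_right]
    · refine Finset.sum_congr rfl fun r _ => ?_
      rw [tBinom_succ_succ ht, Nat.succ_sub_succ]
  have h2 : p * homRS t m p q = p ^ (m + 1) + ∑ r ∈ Finset.range (m + 1),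
      q ^ (r + 1) * p ^ (m - r) * tBinom t m (r + 1) := by
    rw [homRS, Finset.mul_sum, Finset.sum_range_succ', add_comm, Finset.sum_range_succ _ m,
      tBinom_of_lt t (Nat.lt_succ_self m), mul_zero, add_zero]
    congr 1
    · simp [tBinom_zero_right, pow_succ']
    · refine Finset.sum_congr rfl fun r hr => ?_
      have hr' : r < m := Finset.mem_range.mp hr
      rw [show m - r = m - (r + 1) + 1 by omega]
      ring
  rw [h1, h2, homRS, Finset.mul_sum, add_left_comm, ← Finset.sum_add_distrib]
  congr 1
  refine Finset.sum_congr rfl fun r _ => ?_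
  ring

/-- The Rogers–Szegő polynomial as a specialization of its homogeneous form. -/
lemma homRS_one_left (t : F) (m : ℕ) (z : F) : homRS t m 1 z = rogersSzego m z t := by
  simp [homRS, rogersSzego]

lemma homRS_eq_pow_mul {t a : F} (ha : a ≠ 0) (m : ℕ) (b : F) :
    homRS t m a b = a ^ m * rogersSzego m (b / a) t := by
  rw [homRS, rogersSzego, Finset.mul_sum]
  refine Finset.sum_congr rfl fun r hr => ?_
  have hr' : r ≤ m := Nat.lt_succ_iff.mp (Finset.mem_range.mp hr)
  rw [div_pow, ← Nat.add_sub_of_le hr', Nat.add_sub_cancel_left, pow_add]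
  field_simp

end GaussianBinomial

/-! ### Symmetrization over subsets -/

section CrossProd

variable {ι R : Type*} [CommRing R]

/-- The product of `A i j` over `i ∈ S` and `j ∈ T`. -/
def crossProd (A : ι → ι → R) (S T : Finset ι) : R := ∏ i ∈ S, ∏ j ∈ T, A i j

@[simp] lemma crossProd_empty_left (A : ι → ι → R) (T : Finset ι) : crossProd A ∅ T = 1 := by
  simp [crossProd]

lemma map_crossProd {R' : Type*} [CommRing R'] (f : R →+* R') (A : ι → ι → R) (S T : Finset ι) :
    f (crossProd A S T) = crossProd (fun i j => f (A i j)) S T := by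
  simp only [crossProd, map_prod]

variable [DecidableEq ι]

lemma crossProd_union_left (A : ι → ι → R) {S T : Finset ι} (U : Finset ι) (h : Disjoint S T) :
    crossProd A (S ∪ T) U = crossProd A S U * crossProd A T U :=
  Finset.prod_union h

lemma crossProd_union_right (A : ι → ι → R) (S : Finset ι) {T U : Finset ι} (h : Disjoint T U) :
    crossProd A S (T ∪ U) = crossProd A S T * crossProd A S U := by
  simp only [crossProd, Finset.prod_union h, Finset.prod_mul_distrib]

lemma crossProd_insert_left (A : ι → ι → R) {k : ι} {S : Finset ι} (T : Finset ι) (h : k ∉ S) :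
    crossProd A (insert k S) T = (∏ j ∈ T, A k j) * crossProd A S T :=
  Finset.prod_insert h

lemma crossProd_insert_right (A : ι → ι → R) {k : ι} (S : Finset ι) {T : Finset ι} (h : k ∉ T) :
    crossProd A S (insert k T) = (∏ i ∈ S, A i k) * crossProd A S T := by
  simp only [crossProd, Finset.prod_insert h, Finset.prod_mul_distrib]

lemma insert_sdiff_insert_of_mem {k : ι} {Y S : Finset ι} (hk : k ∉ Y) :
    insert k Y \ insert k S = Y \ S := by
  ext i
  simp only [Finset.mem_sdiff, Finset.mem_insert]
  grind

/-- Split the subsets of `insert k Y` according to whether they contain `k`. -/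
lemma sum_powerset_insert_sdiff {M : Type*} [AddCommMonoid M] {k : ι} {Y : Finset ι} (hk : k ∉ Y)
    (f : Finset ι → Finset ι → M) :
    ∑ S ∈ (insert k Y).powerset, f S (insert k Y \ S) =
      ∑ S ∈ Y.powerset, (f (insert k S) (Y \ S) + f S (insert k (Y \ S))) := by
  rw [Finset.sum_powerset_insert hk, add_comm, ← Finset.sum_add_distrib]
  refine Finset.sum_congr rfl fun S hS => ?_
  have hkS : k ∉ S := fun h => hk (Finset.mem_powerset.mp hS h)
  rw [insert_sdiff_insert_of_mem hk, Finset.insert_sdiff_of_notMem _ hkS]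

end CrossProd

/-! ### Subset sums as polynomials in one of the values -/

section Interpolation

open Polynomial

variable {ι F : Type*} [DecidableEq ι] [Field F]

/-- The factor `(x_i - t x_j) / (x_i - x_j)` of a Hall–Littlewood polynomial. -/
def hlRatio (t : F) (x : ι → F) (i j : ι) : F := (x i - t * x j) / (x i - x j)

/-- Sums over the subsets of `Y ∪ {z}` of the kind considered here are polynomials in the value
`z`. The weights of the subset `S ∪ {z}` and of the subset `S` are `a S` and `b S`; the
compatibility `hab`, which holds for weights symmetric in all the values, makes the residues at
`z = x_k` cancel. -/
lemma exists_polynomial_of_subset_sum (t : F) (x : ι → F) (Y : Finset ι) (hx : Set.InjOn x Y)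
    (d : ℕ) (a b : Finset ι → F[X])
    (ha : ∀ S ⊆ Y, (a S).natDegree ≤ d) (hb : ∀ S ⊆ Y, (b S).natDegree ≤ d)
    (hab : ∀ S ⊆ Y, ∀ k ∈ Y, k ∉ S → (a S).eval (x k) = (b (insert k S)).eval (x k)) :
    ∃ P : F[X], P.natDegree ≤ d ∧
      P.coeff d = ∑ S ∈ Y.powerset, crossProd (hlRatio t x) S (Y \ S) *
        ((a S).coeff d + t ^ S.card * (b S).coeff d) ∧
      ∀ z, (∀ k ∈ Y, z ≠ x k) →
        P.eval z = ∑ S ∈ Y.powerset, crossProd (hlRatio t x) S (Y \ S) *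
          ((a S).eval z * ∏ j ∈ Y \ S, (z - t * x j) / (z - x j) +
            (b S).eval z * ∏ i ∈ S, (x i - t * z) / (x i - z)) := by
  -- numerators over the common denominator `∏ (z - x_k)`
  let u : Finset ι → ι → F[X] := fun S i => if i ∈ S then X - C (x i) else X - C (t * x i)
  let v : Finset ι → ι → F[X] := fun S i => if i ∈ S then C t * X - C (x i) else X - C (x i)
  have hu1 : ∀ S i, (u S i).natDegree ≤ 1 := fun S i => by
    simp only [u]; split_ifs <;> exact natDegree_X_sub_C_le _
  have hv1 : ∀ S i, (v S i).natDegree ≤ 1 := fun S i => by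
    simp only [v]
    split_ifs
    · compute_degree
    · simp
  have huc : ∀ S, (∏ i ∈ Y, u S i).coeff Y.card = 1 := fun S => by
    have := coeff_prod_of_natDegree_le Y (u S) 1 (fun i _ => hu1 S i)
    rw [mul_one] at this
    rw [this]
    refine Finset.prod_eq_one fun i _ => ?_
    simp only [u]; split_ifs <;> simp
  have hvc : ∀ S ⊆ Y, (∏ i ∈ Y, v S i).coeff Y.card = t ^ S.card := fun S hS => by
    have := coeff_prod_of_natDegree_le Y (v S) 1 (fun i _ => hv1 S i)
    rw [mul_one] at this
    rw [this, ← Finset.prod_sdiff hS]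
    rw [Finset.prod_eq_one, one_mul, Finset.prod_eq_pow_card (b := t)]
    · intro i hi
      simp [v, hi, coeff_C]
    · intro i hi
      simp [v, (Finset.mem_sdiff.mp hi).2]
  have hud : ∀ S, (∏ i ∈ Y, u S i).natDegree ≤ Y.card := fun S =>
    (natDegree_prod_le Y (u S)).trans
      ((Finset.sum_le_sum fun i _ => hu1 S i).trans (by simp))
  have hvd : ∀ S, (∏ i ∈ Y, v S i).natDegree ≤ Y.card := fun S =>
    (natDegree_prod_le Y (v S)).trans
      ((Finset.sum_le_sum fun i _ => hv1 S i).trans (by simp))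
  let N : F[X] := ∑ S ∈ Y.powerset, C (crossProd (hlRatio t x) S (Y \ S)) *
    (a S * ∏ i ∈ Y, u S i + b S * ∏ i ∈ Y, v S i)
  have hNd : N.natDegree ≤ d + Y.card := by
    refine natDegree_sum_le_of_forall_le _ _ fun S hS => ?_
    have hS' := Finset.mem_powerset.mp hS
    refine (natDegree_C_mul_le _ _).trans (natDegree_add_le_of_degree_le ?_ ?_)
    · exact natDegree_mul_le_of_le (ha S hS') (hud S)
    · exact natDegree_mul_le_of_le (hb S hS') (hvd S)
  have hNc : N.coeff (d + Y.card) = ∑ S ∈ Y.powerset, crossProd (hlRatio t x) S (Y \ S) *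
        ((a S).coeff d + t ^ S.card * (b S).coeff d) := by
    rw [finsetSum_coeff]
    refine Finset.sum_congr rfl fun S hS => ?_
    have hS' := Finset.mem_powerset.mp hS
    rw [coeff_C_mul, coeff_add, coeff_mul_add_eq_of_natDegree_le (ha S hS') (hud S),
      coeff_mul_add_eq_of_natDegree_le (hb S hS') (hvd S), huc, hvc S hS']
    ring
  have hroot : ∀ k ∈ Y, N.eval (x k) = 0 := by
    intro k hk
    obtain ⟨Y', hkY', rfl⟩ : ∃ Y', k ∉ Y' ∧ Y = insert k Y' :=
      ⟨Y.erase k, Finset.notMem_erase k Y, (Finset.insert_erase hk).symm⟩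
    have hne : ∀ i ∈ Y', x k - x i ≠ 0 := fun i hi h =>
      hkY' (hx (Finset.mem_insert_self k Y') (Finset.mem_insert_of_mem hi) (sub_eq_zero.mp h) ▸ hi)
    simp only [N, eval_finsetSum, eval_mul, eval_C]
    rw [Finset.sum_powerset_insert hkY', ← Finset.sum_add_distrib]
    refine Finset.sum_eq_zero fun S hS => ?_
    have hS' := Finset.mem_powerset.mp hS
    have hkS : k ∉ S := fun h => hkY' (hS' h)
    have e1 : (v S k).eval (x k) = 0 := by simp [v, hkS]
    have e2 : (u (insert k S) k).eval (x k) = 0 := by simp [u]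
    rw [insert_sdiff_insert_of_mem hkY', Finset.insert_sdiff_of_notMem _ hkS,
      crossProd_insert_left _ _ hkS, crossProd_insert_right _ _ (by simp [hkY'])]
    simp only [eval_add, eval_mul, eval_prod, Finset.prod_insert hkY', e1, e2, zero_mul, mul_zero,
      add_zero, zero_add]
    rw [hab S (hS'.trans (Finset.subset_insert _ _)) k (Finset.mem_insert_self _ _) hkS]
    have e3 : (u S k).eval (x k) = x k - t * x k := by simp [u, hkS]
    have e4 : (v (insert k S) k).eval (x k) = -(x k - t * x k) := by simp [v]
    have e5 : (∏ i ∈ S, hlRatio t x i k) * ∏ i ∈ Y', (u S i).eval (x k) =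
        (∏ j ∈ Y' \ S, hlRatio t x k j) * ∏ i ∈ Y', (v (insert k S) i).eval (x k) := by
      rw [← Finset.prod_sdiff hS', ← Finset.prod_sdiff hS', mul_comm (∏ i ∈ Y' \ S, _),
        ← mul_assoc, ← mul_assoc, ← Finset.prod_mul_distrib, ← Finset.prod_mul_distrib, mul_comm]
      congr 1
      · refine Finset.prod_congr rfl fun j hj => ?_
        have h := Finset.mem_sdiff.mp hj
        have hjk : j ≠ k := fun e => hkY' (e ▸ h.1)
        have := hne j h.1
        simp only [u, v, h.2, Finset.mem_insert, hjk, hlRatio, if_false, or_self, eval_sub, eval_X,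
          eval_C]
        field_simp
      · refine Finset.prod_congr rfl fun i hi => ?_
        have := hne i (hS' hi)
        have h2 : x i - x k ≠ 0 := by rwa [← neg_ne_zero, neg_sub]
        simp only [u, v, hi, Finset.mem_insert, hlRatio, if_true, or_true, eval_sub, eval_X,
          eval_C, eval_mul]
        rw [div_mul_eq_mul_div, div_eq_iff h2]
        ring
    rw [e3, e4]
    linear_combination (crossProd (hlRatio t x) S (Y' \ S) * (b (insert k S)).eval (x k) *
      (x k - t * x k)) * e5
  -- hence the common denominator divides the numerator
  let D : F[X] := ∏ k ∈ Y, (X - C (x k))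
  have hDm : D.Monic := monic_prod_X_sub_C x Y
  have hDd : D.natDegree = Y.card := natDegree_finsetProd_X_sub_C_eq_card Y x
  obtain ⟨P, hP⟩ : D ∣ N := by
    refine Finset.prod_dvd_of_coprime ?_ fun k hk => dvd_iff_isRoot.mpr (hroot k hk)
    intro i hi j hj hij
    exact isCoprime_X_sub_C_of_isUnit_sub (sub_ne_zero.mpr fun e => hij (hx hi hj e)).isUnit
  have hPd : P.natDegree ≤ d := by
    rcases eq_or_ne P 0 with rfl | h0
    · simp
    · have := hDm.natDegree_mul' h0
      rw [← hP, hDd] at this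
      omega
  refine ⟨P, hPd, ?_, ?_⟩
  · rw [← hNc, hP, add_comm d, coeff_mul_add_eq_of_natDegree_le hDd.le hPd, ← hDd,
      hDm.coeff_natDegree, one_mul]
  · intro z hz
    have hz' : ∀ k ∈ Y, z - x k ≠ 0 := fun k hk => sub_ne_zero.mpr (hz k hk)
    have hD0 : D.eval z ≠ 0 := by
      simp only [D, eval_prod, eval_sub, eval_X, eval_C]
      exact Finset.prod_ne_zero_iff.mpr hz'
    apply mul_left_cancel₀ hD0
    rw [← eval_mul, ← hP, Finset.mul_sum]
    simp only [N, eval_finsetSum, eval_mul, eval_C]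
    refine Finset.sum_congr rfl fun S hS => ?_
    have hS' := Finset.mem_powerset.mp hS
    have e1 : (∏ i ∈ Y, u S i).eval z = D.eval z * ∏ j ∈ Y \ S, (z - t * x j) / (z - x j) := by
      simp only [D, eval_prod]
      rw [← Finset.prod_sdiff hS', ← Finset.prod_sdiff hS', mul_right_comm,
        ← Finset.prod_mul_distrib]
      congr 1
      · refine Finset.prod_congr rfl fun j hj => ?_
        have h := Finset.mem_sdiff.mp hj
        have := hz' j h.1
        simp only [u, h.2, if_false, eval_sub, eval_X, eval_C]
        field_simp
      · refine Finset.prod_congr rfl fun i hi => ?_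
        simp [u, hi]
    have e2 : (∏ i ∈ Y, v S i).eval z = D.eval z * ∏ i ∈ S, (x i - t * z) / (x i - z) := by
      simp only [D, eval_prod]
      rw [← Finset.prod_sdiff hS', ← Finset.prod_sdiff hS', mul_assoc,
        ← Finset.prod_mul_distrib]
      congr 1
      · refine Finset.prod_congr rfl fun j hj => ?_
        have h := Finset.mem_sdiff.mp hj
        simp [v, h.2]
      · refine Finset.prod_congr rfl fun i hi => ?_
        have := hz' i (hS' hi)
        have h2 : x i - z ≠ 0 := by rwa [← neg_ne_zero, neg_sub]
        simp only [v, hi, if_true, eval_sub, eval_X, eval_C, eval_mul]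
        rw [mul_div_assoc', eq_div_iff h2]
        ring
    rw [eval_add, eval_mul, eval_mul, e1, e2]
    ring

end Interpolation

/-! ### Gaussian binomials and elementary symmetric polynomials as subset sums -/

section SubsetIdentities

open Polynomial

variable {ι F : Type*} [DecidableEq ι] [Field F]

/-- Separate the index `k` in a sum over the subsets of `insert k Y`. -/
lemma sum_powerset_insert_crossProd (t : F) (x : ι → F) {k : ι} {Y : Finset ι} (hk : k ∉ Y)
    (W : Finset ι → Finset ι → F) :
    ∑ S ∈ (insert k Y).powerset, W S (insert k Y \ S) *
        crossProd (hlRatio t x) S (insert k Y \ S) =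
      ∑ S ∈ Y.powerset, crossProd (hlRatio t x) S (Y \ S) *
        (W (insert k S) (Y \ S) * ∏ j ∈ Y \ S, (x k - t * x j) / (x k - x j) +
          W S (insert k (Y \ S)) * ∏ i ∈ S, (x i - t * x k) / (x i - x k)) := by
  rw [sum_powerset_insert_sdiff hk fun S T => W S T * crossProd (hlRatio t x) S T]
  refine Finset.sum_congr rfl fun S hS => ?_
  have hkS : k ∉ S := fun h => hk (Finset.mem_powerset.mp hS h)
  rw [crossProd_insert_left _ _ hkS, crossProd_insert_right _ _ (by simp [hk])]
  simp only [hlRatio]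
  ring

lemma eq_of_natDegree_zero {P : F[X]} (h : P.natDegree ≤ 0) (z w : F) : P.eval z = P.eval w := by
  rw [eq_C_of_natDegree_le_zero h, eval_C, eval_C]

/-- The symmetrization of the constant `1` over subsets of given size is a Gaussian binomial
coefficient: as a function of one of the values the sum is a polynomial of degree `0`, and may be
evaluated at `0`. -/
theorem sum_crossProd_eq_homRS {t : F} (ht : ∀ m : ℕ, 0 < m → t ^ m ≠ 1) (x : ι → F)
    (hx : Function.Injective x) (hx0 : ∀ i, x i ≠ 0) (Y : Finset ι) (p q : F) :
    ∑ S ∈ Y.powerset, q ^ S.card * p ^ (Y \ S).card * crossProd (hlRatio t x) S (Y \ S) =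
      homRS t Y.card p q := by
  induction Y using Finset.induction_on generalizing p with
  | empty => simp [homRS_zero]
  | insert k Y hk ih =>
    rw [sum_powerset_insert_crossProd t x hk fun S T => q ^ S.card * p ^ T.card,
      Finset.card_insert_of_notMem hk, homRS_succ ht]
    obtain ⟨P, hPd, -, hP⟩ := exists_polynomial_of_subset_sum t x Y hx.injOn 0
      (fun S => C (q ^ (S.card + 1) * p ^ (Y \ S).card))
      (fun S => C (q ^ S.card * p ^ ((Y \ S).card + 1)))
      (fun S _ => (natDegree_C _).le) (fun S _ => (natDegree_C _).le) (by
        intro S hS l hl hlS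
        have h1 : Y \ S = insert l (Y \ insert l S) := by
          ext i; simp only [Finset.mem_sdiff, Finset.mem_insert]; grind
        have h2 : (Y \ S).card = (Y \ insert l S).card + 1 := by
          rw [h1, Finset.card_insert_of_notMem (by simp)]
        rw [eval_C, eval_C, Finset.card_insert_of_notMem hlS, h2])
    have e1 := hP (x k) fun i hi e => hk (hx e ▸ hi)
    have e2 := hP 0 fun i _ e => hx0 i e.symm
    rw [eq_of_natDegree_zero hPd (x k) 0, e2] at e1
    simp only [eval_C] at e1
    refine Eq.trans (Finset.sum_congr rfl fun S hS => ?_) (e1.symm.trans ?_)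
    · have hkS : k ∉ S := fun h => hk (Finset.mem_powerset.mp hS h)
      rw [Finset.card_insert_of_notMem hkS, Finset.card_insert_of_notMem (by simp [hk])]
    · rw [← ih (t * p), ← ih p, Finset.mul_sum, Finset.mul_sum, ← Finset.sum_add_distrib]
      refine Finset.sum_congr rfl fun S hS => ?_
      have h1 : ∏ j ∈ Y \ S, (0 - t * x j) / (0 - x j) = t ^ (Y \ S).card := by
        refine Finset.prod_eq_pow_card fun j _ => ?_
        rw [zero_sub, zero_sub, neg_div_neg_eq, mul_div_cancel_right₀ _ (hx0 j)]
      have h2 : ∏ i ∈ S, (x i - t * 0) / (x i - 0) = 1 := by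
        refine Finset.prod_eq_one fun j _ => ?_
        rw [mul_zero, sub_zero, div_self (hx0 j)]
      rw [h1, h2]
      ring

/-- The generating function of the elementary symmetric polynomials as a symmetrization over
subsets, that is `P_{(1^r)} = e_r`. As a function of one of the values the sum is a polynomial of
degree `1`, determined by its value at `0` and its leading coefficient. -/
theorem sum_crossProd_eq_prod_one_add {t : F} (x : ι → F)
    (hx : Function.Injective x) (hx0 : ∀ i, x i ≠ 0) (Y : Finset ι) (b : F) :
    ∑ S ∈ Y.powerset, (∏ i ∈ S, b * x i) * crossProd (hlRatio t x) S (Y \ S) =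
      ∏ i ∈ Y, (1 + b * x i) := by
  induction Y using Finset.induction_on with
  | empty => simp
  | insert k Y hk ih =>
    rw [sum_powerset_insert_crossProd t x hk fun S _ => ∏ i ∈ S, b * x i, Finset.prod_insert hk]
    obtain ⟨P, hPd, hPc, hP⟩ := exists_polynomial_of_subset_sum t x Y hx.injOn 1
      (fun S => C (b * ∏ i ∈ S, b * x i) * X) (fun S => C (∏ i ∈ S, b * x i))
      (fun S _ => (natDegree_C_mul_le _ _).trans natDegree_X_le)
      (fun S _ => (natDegree_C _).le.trans zero_le_one) (by
        intro S hS l hl hlS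
        rw [eval_mul, eval_C, eval_X, eval_C, Finset.prod_insert hlS]
        ring)
    have e1 := hP (x k) fun i hi e => hk (hx e ▸ hi)
    have e2 := hP 0 fun i _ e => hx0 i e.symm
    have e3 : P.coeff 1 = b * ∏ i ∈ Y, (1 + b * x i) := by
      rw [hPc, ← ih, Finset.mul_sum]
      refine Finset.sum_congr rfl fun S _ => ?_
      rw [coeff_C_mul_X, if_pos rfl, coeff_C, if_neg one_ne_zero]
      ring
    have e4 : P.coeff 0 = ∏ i ∈ Y, (1 + b * x i) := by
      rw [coeff_zero_eq_eval_zero, e2, ← ih]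
      refine Finset.sum_congr rfl fun S _ => ?_
      have h2 : ∏ i ∈ S, (x i - t * 0) / (x i - 0) = 1 := by
        refine Finset.prod_eq_one fun j _ => ?_
        rw [mul_zero, sub_zero, div_self (hx0 j)]
      simp only [eval_mul, eval_X, eval_C, h2]
      ring
    have e5 : P.eval (x k) = (1 + b * x k) * ∏ i ∈ Y, (1 + b * x i) := by
      rw [eq_X_add_C_of_natDegree_le_one hPd, e3, e4]
      simp only [eval_add, eval_mul, eval_C, eval_X]
      ring
    rw [← e5, e1]
    refine Finset.sum_congr rfl fun S hS => ?_
    have hkS : k ∉ S := fun h => hk (Finset.mem_powerset.mp hS h)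
    rw [Finset.prod_insert hkS]
    simp only [eval_mul, eval_C, eval_X]
    ring

end SubsetIdentities

/-! ### The product over pairs -/

section PairProd

variable {ι R : Type*} [LinearOrder ι] [CommRing R]

/-- The product of `φ i j` over the pairs `i < j` in `X`. -/
def pairProd (φ : ι → ι → R) (X : Finset ι) : R := ∏ i ∈ X, ∏ j ∈ X, if i < j then φ i j else 1

@[simp] lemma pairProd_empty (φ : ι → ι → R) : pairProd φ ∅ = 1 := by simp [pairProd]

lemma pairProd_insert {φ : ι → ι → R} (hφ : ∀ i j, φ i j = φ j i) {k : ι} {X : Finset ι}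
    (hk : k ∉ X) : pairProd φ (insert k X) = (∏ j ∈ X, φ k j) * pairProd φ X := by
  simp only [pairProd, Finset.prod_insert hk, lt_irrefl, if_false, one_mul,
    Finset.prod_mul_distrib]
  rw [← mul_assoc, ← Finset.prod_mul_distrib]
  congr 1
  refine Finset.prod_congr rfl fun j hj => ?_
  rcases lt_trichotomy k j with h | h | h
  · rw [if_pos h, if_neg h.not_gt, mul_one]
  · exact absurd (h ▸ hj) hk
  · rw [if_neg h.not_gt, if_pos h, one_mul, hφ]

lemma pairProd_union {φ : ι → ι → R} (hφ : ∀ i j, φ i j = φ j i) {S T : Finset ι}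
    (h : Disjoint S T) :
    pairProd φ (S ∪ T) = pairProd φ S * pairProd φ T * crossProd φ S T := by
  induction S using Finset.induction_on with
  | empty => simp
  | insert k S hk ih =>
    rw [Finset.disjoint_insert_left] at h
    rw [Finset.insert_union, pairProd_insert hφ (by simp [hk, h.1]), ih h.2,
      pairProd_insert hφ hk, Finset.prod_union h.2, crossProd_insert_left _ _ hk]
    ring

lemma map_pairProd {R' : Type*} [CommRing R'] (f : R →+* R') (φ : ι → ι → R) (X : Finset ι) :
    f (pairProd φ X) = pairProd (fun i j => f (φ i j)) X := by
  simp only [pairProd, map_prod, apply_ite f, map_one]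

end PairProd

/-! ### The rational identity behind Littlewood's sum -/

section LittlewoodRecursion

open Polynomial

variable {ι R F : Type*} [LinearOrder ι] [CommRing R] [Field F]

/-- The weight of the splitting of the variables into `S` and `T` in the cleared form of the
recursion for the product `∏ 1 / (1 - x_i) * ∏ (1 - t x_i x_j) / (1 - x_i x_j)`. -/
def littlewoodWeight (t : R) (x : ι → R) (S T : Finset ι) : R :=
  (∏ i ∈ S, x i) * (∏ j ∈ T, (1 - x j)) * crossProd (fun i j => 1 - x i * x j) S T *
    pairProd (fun i j => 1 - t * x i * x j) S * pairProd (fun i j => 1 - x i * x j) T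

lemma littlewoodWeight_insert_left (t : R) (x : ι → R) {k : ι} {S : Finset ι} (T : Finset ι)
    (hk : k ∉ S) : littlewoodWeight t x (insert k S) T =
      littlewoodWeight t x S T * (x k * ((∏ j ∈ T, (1 - x j * x k)) *
        ∏ i ∈ S, (1 - t * x i * x k))) := by
  rw [littlewoodWeight, littlewoodWeight, Finset.prod_insert hk, crossProd_insert_left _ _ hk,
    pairProd_insert (fun i j => by ring) hk]
  simp only [mul_right_comm t (x k), mul_comm (x k)]
  ring

lemma littlewoodWeight_insert_right (t : R) (x : ι → R) {k : ι} (S : Finset ι) {T : Finset ι}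
    (hk : k ∉ T) : littlewoodWeight t x S (insert k T) =
      littlewoodWeight t x S T * ((1 - x k) * ((∏ i ∈ S, (1 - x i * x k)) *
        ∏ j ∈ T, (1 - x j * x k))) := by
  rw [littlewoodWeight, littlewoodWeight, Finset.prod_insert hk, crossProd_insert_right _ _ hk,
    pairProd_insert (fun i j => by ring) hk]
  simp only [mul_comm (x k)]
  ring

/-- The cleared form of the recursion for the product
`∏ 1 / (1 - x_i) * ∏ (1 - t x_i x_j) / (1 - x_i x_j)`. As a function of one of the values `z`, both
sides are polynomials of degree at most the number of the values; they are compared at `z = 0`,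
at `z = 1` and at the inverses of the other values. -/
theorem sum_littlewoodWeight {t : F} (x : ι → F) (hx : Function.Injective x) (hx0 : ∀ i, x i ≠ 0)
    (hx1 : ∀ i, x i ≠ 1) (hxx : ∀ i j, x i * x j ≠ 1) (X : Finset ι) :
    ∑ S ∈ X.powerset, littlewoodWeight t x S (X \ S) * crossProd (hlRatio t x) S (X \ S) =
      pairProd (fun i j => 1 - t * x i * x j) X := by
  classical
  induction hn : X.card using Nat.strong_induction_on generalizing X with
  | _ n ih =>
  rcases X.eq_empty_or_nonempty with rfl | ⟨k, hkX⟩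
  · simp [littlewoodWeight]
  obtain ⟨Y, hk, rfl⟩ : ∃ Y, k ∉ Y ∧ X = insert k Y :=
    ⟨X.erase k, Finset.notMem_erase k X, (Finset.insert_erase hkX).symm⟩
  rw [Finset.card_insert_of_notMem hk] at hn
  have ihY := ih Y.card (by omega) Y rfl
  have hsym : ∀ i j, 1 - t * x i * x j = 1 - t * x j * x i := fun i j => by ring
  have hlin : ∀ c : F, (1 - C c * (X : F[X])).natDegree ≤ 1 := fun c => by compute_degree
  have hlins : ∀ (S : Finset ι) (c : ι → F),
      (∏ i ∈ S, (1 - C (c i) * (X : F[X]))).natDegree ≤ S.card := fun S c =>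
    (natDegree_prod_le _ _).trans ((Finset.sum_le_sum fun i _ => hlin (c i)).trans (by simp))
  obtain ⟨P, hPd, -, hP⟩ := exists_polynomial_of_subset_sum t x Y hx.injOn (Y.card + 1)
    (fun S => C (littlewoodWeight t x S (Y \ S)) * (X * ((∏ j ∈ Y \ S, (1 - C (x j) * X)) *
      ∏ i ∈ S, (1 - C (t * x i) * X))))
    (fun S => C (littlewoodWeight t x S (Y \ S)) * ((1 - X) * ((∏ i ∈ S, (1 - C (x i) * X)) *
      ∏ j ∈ Y \ S, (1 - C (x j) * X))))
    (fun S hS => by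
      refine (natDegree_C_mul_le _ _).trans ((natDegree_mul_le_of_le natDegree_X_le
        (natDegree_mul_le_of_le (hlins _ _) (hlins _ _))).trans ?_)
      rw [Finset.card_sdiff_add_card_eq_card hS, add_comm])
    (fun S hS => by
      refine (natDegree_C_mul_le _ _).trans ((natDegree_mul_le_of_le (m := 1) ?_
        (natDegree_mul_le_of_le (hlins _ _) (hlins _ _))).trans ?_)
      · compute_degree
      · rw [add_comm S.card, Finset.card_sdiff_add_card_eq_card hS, add_comm])
    (by
      intro S hS l hl hlS
      have h1 : Y \ S = insert l (Y \ insert l S) := by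
        ext i; simp only [Finset.mem_sdiff, Finset.mem_insert]; grind
      have h2 : l ∉ Y \ insert l S := by simp
      rw [h1, littlewoodWeight_insert_right _ _ _ h2, littlewoodWeight_insert_left _ _ _ hlS]
      simp only [eval_mul, eval_C, eval_X, eval_prod, eval_sub, eval_one, Finset.prod_insert h2,
        Finset.prod_insert hlS]
      ring)
  let Q : F[X] := C (pairProd (fun i j => 1 - t * x i * x j) Y) * ∏ j ∈ Y, (1 - C (t * x j) * X)
  have hQd : Q.natDegree ≤ Y.card + 1 :=
    (natDegree_C_mul_le _ _).trans ((hlins _ _).trans (Nat.le_succ _))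
  have hPQ : P = Q := by
    refine eq_of_natDegree_lt_card_of_eval_eq' P Q
      (insert 0 (insert 1 (Y.image fun l => (x l)⁻¹))) ?_ ?_
    · intro z hz
      simp only [Finset.mem_insert, Finset.mem_image] at hz
      rcases hz with rfl | rfl | ⟨l, hl, rfl⟩
      · rw [hP 0 fun i _ e => hx0 i e.symm]
        simp only [Q, eval_mul, eval_C, eval_X, eval_prod, eval_sub, eval_one, mul_zero, sub_zero,
          Finset.prod_const_one, mul_one, zero_mul, zero_add]
        rw [← ihY]
        refine Finset.sum_congr rfl fun S _ => ?_
        rw [Finset.prod_eq_one (s := S) fun i _ => div_self (hx0 i), mul_one, mul_comm]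
      · rw [hP 1 fun i _ e => hx1 i e.symm]
        simp only [Q, eval_mul, eval_C, eval_X, eval_prod, eval_sub, eval_one, mul_one, sub_self,
          zero_mul, mul_zero, add_zero, one_mul]
        rw [← ihY, Finset.sum_mul]
        refine Finset.sum_congr rfl fun S hS => ?_
        rw [← Finset.prod_sdiff (Finset.mem_powerset.mp hS)]
        have e : (∏ j ∈ Y \ S, (1 - x j)) * ∏ j ∈ Y \ S, (1 - t * x j) / (1 - x j) =
            ∏ j ∈ Y \ S, (1 - t * x j) := by
          rw [← Finset.prod_mul_distrib]
          refine Finset.prod_congr rfl fun j _ => ?_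
          rw [mul_div_cancel₀ _ (sub_ne_zero.mpr (hx1 j).symm)]
        rw [← e]
        ring
      · have hzx : ∀ i, (x l)⁻¹ ≠ x i := fun i e => hxx i l (by
          rw [← e, inv_mul_cancel₀ (hx0 l)])
        rw [hP _ fun i _ => hzx i]
        obtain ⟨Y', hlY', rfl⟩ : ∃ Y', l ∉ Y' ∧ Y = insert l Y' :=
          ⟨Y.erase l, Finset.notMem_erase l Y, (Finset.insert_erase hl).symm⟩
        rw [Finset.card_insert_of_notMem hlY'] at hn
        have ihY' := ih Y'.card (by omega) Y' rfl
        have hx0l := hx0 l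
        have hzl : 1 - x l * (x l)⁻¹ = 0 := by rw [mul_inv_cancel₀ hx0l, sub_self]
        simp only [Q, eval_mul, eval_C, eval_X, eval_prod, eval_sub, eval_one]
        rw [pairProd_insert hsym hlY', ← ihY', Finset.mul_sum, Finset.sum_mul,
          Finset.sum_powerset_insert hlY', Finset.sum_eq_zero, zero_add]
        · refine Finset.sum_congr rfl fun S hS => ?_
          have hS' := Finset.mem_powerset.mp hS
          have hlS : l ∉ S := fun h => hlY' (hS' h)
          rw [insert_sdiff_insert_of_mem hlY', littlewoodWeight_insert_left _ _ _ hlS,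
            crossProd_insert_left _ _ hlS]
          simp only [Finset.prod_insert hlS, Finset.prod_insert hlY', hzl, zero_mul, mul_zero,
            add_zero]
          rw [← Finset.prod_sdiff hS', ← Finset.prod_sdiff hS']
          have e : (∏ j ∈ Y' \ S, hlRatio t x l j) * ((∏ j ∈ Y' \ S, (1 - x j * x l)) *
              ((∏ j ∈ Y' \ S, (1 - x j * (x l)⁻¹)) *
              ∏ j ∈ Y' \ S, ((x l)⁻¹ - t * x j) / ((x l)⁻¹ - x j))) =
              (∏ j ∈ Y' \ S, (1 - t * x l * x j)) * ∏ j ∈ Y' \ S, (1 - t * x j * (x l)⁻¹) := by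
            simp only [← Finset.prod_mul_distrib]
            refine Finset.prod_congr rfl fun j hj => ?_
            have h1 : x l - x j ≠ 0 := sub_ne_zero.mpr fun e =>
              hlY' (hx e ▸ (Finset.mem_sdiff.mp hj).1)
            have h2 : 1 - x l * x j ≠ 0 := sub_ne_zero.mpr (hxx l j).symm
            have h3 : (x l)⁻¹ - x j = (1 - x l * x j) / x l := by field_simp
            rw [hlRatio, h3]
            field_simp
          have e' : ∏ i ∈ S, (1 - t * x i * x l) = ∏ i ∈ S, (1 - t * x l * x i) :=
            Finset.prod_congr rfl fun i _ => by ring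
          rw [e']
          have hxl : x l * (x l)⁻¹ = 1 := mul_inv_cancel₀ hx0l
          have e1 := congrArg (fun w => littlewoodWeight t x S (Y' \ S) *
            crossProd (hlRatio t x) S (Y' \ S) * (∏ i ∈ S, (1 - t * x l * x i)) *
            (∏ i ∈ S, (1 - t * x i * (x l)⁻¹)) * (1 - t * x l * (x l)⁻¹) * w) e
          simp only at e1
          linear_combination e1 + hxl *
            (littlewoodWeight t x S (Y' \ S) *
            crossProd (hlRatio t x) S (Y' \ S) * (∏ i ∈ S, (1 - t * x l * x i)) *
            (∏ i ∈ S, (1 - t * x i * (x l)⁻¹)) * (1 - t * x l * (x l)⁻¹) *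
            ((∏ j ∈ Y' \ S, hlRatio t x l j) * ((∏ j ∈ Y' \ S, (1 - x j * x l)) *
              ((∏ j ∈ Y' \ S, (1 - x j * (x l)⁻¹)) *
              ∏ j ∈ Y' \ S, ((x l)⁻¹ - t * x j) / ((x l)⁻¹ - x j)))))
        · intro S hS
          have hlS : l ∉ S := fun h => hlY' (Finset.mem_powerset.mp hS h)
          rw [Finset.insert_sdiff_of_notMem _ hlS]
          have h2 : l ∉ Y' \ S := by simp [hlY']
          simp only [Finset.prod_insert h2, hzl, zero_mul, mul_zero, add_zero]
    · have hc : (insert 0 (insert 1 (Y.image fun l => (x l)⁻¹))).card = Y.card + 2 := by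
        rw [Finset.card_insert_of_notMem, Finset.card_insert_of_notMem,
          Finset.card_image_of_injective]
        · exact fun i j h => hx (inv_injective h)
        · simp only [Finset.mem_image, not_exists, not_and]
          exact fun i _ e => hx1 i (inv_eq_one.mp e)
        · simp only [Finset.mem_insert, Finset.mem_image, zero_ne_one, false_or, not_exists,
            not_and]
          exact fun i _ e => hx0 i (inv_eq_zero.mp e)
      rw [hc]
      exact max_lt (by omega) (by omega)
  have e1 := hP (x k) fun i hi e => hk (hx e ▸ hi)
  rw [sum_powerset_insert_crossProd t x hk (littlewoodWeight t x), pairProd_insert hsym hk]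
  have e2 : Q.eval (x k) = (∏ j ∈ Y, (1 - t * x k * x j)) *
      pairProd (fun i j => 1 - t * x i * x j) Y := by
    simp only [Q, eval_mul, eval_C, eval_X, eval_prod, eval_sub, eval_one]
    rw [mul_comm]
    congr 1
    exact Finset.prod_congr rfl fun j _ => by ring
  rw [← e2, ← hPQ, e1]
  refine Finset.sum_congr rfl fun S hS => ?_
  have hkS : k ∉ S := fun h => hk (Finset.mem_powerset.mp hS h)
  rw [littlewoodWeight_insert_left _ _ _ hkS, littlewoodWeight_insert_right _ _ _ (by simp [hk])]
  simp only [eval_mul, eval_C, eval_X, eval_prod, eval_sub, eval_one]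

end LittlewoodRecursion

/-! ### Operators on series indexed by sets of variables -/

section Operators

open PowerSeries

variable {ι F : Type*} [Field F]

/-- The variable `x_i`, with its degree recorded by the formal variable. -/
noncomputable def gradedVar (x : ι → F) (i : ι) : F⟦X⟧ := X * C (x i)

/-- Multiplication by the product of the variables in the set. -/
noncomputable def mulVars (x : ι → F) (φ : Finset ι → F⟦X⟧) (Y : Finset ι) : F⟦X⟧ :=
  (∏ i ∈ Y, gradedVar x i) * φ Y

/-- Multiplication by the product of the `1 + b x_i` over the variables in the set. -/
noncomputable def mulElem (x : ι → F) (b : F) (φ : Finset ι → F⟦X⟧) (Y : Finset ι) : F⟦X⟧ :=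
  (∏ i ∈ Y, (1 + C b * gradedVar x i)) * φ Y

lemma mulElem_mulVars (x : ι → F) (b : F) (φ : Finset ι → F⟦X⟧) :
    mulElem x b (mulVars x φ) = mulVars x (mulElem x b φ) := by
  funext Y
  simp only [mulElem, mulVars]
  ring

section FractionField

variable (t : F) (x : ι → F)

lemma hlRatio_gradedVar (i j : ι) :
    hlRatio (algebraMap F⟦X⟧ (FractionRing F⟦X⟧) (C t))
      (fun k => algebraMap F⟦X⟧ (FractionRing F⟦X⟧) (gradedVar x k)) i j =
      algebraMap F⟦X⟧ (FractionRing F⟦X⟧) (C (hlRatio t x i j)) := by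
  have hX : algebraMap F⟦X⟧ (FractionRing F⟦X⟧) X ≠ 0 := by
    rw [Ne, IsFractionRing.to_map_eq_zero_iff]
    exact X_ne_zero
  have h1 : ∀ f : F, algebraMap F⟦X⟧ (FractionRing F⟦X⟧) (C f) =
      ((algebraMap F⟦X⟧ (FractionRing F⟦X⟧)).comp C) f := fun _ => rfl
  simp only [hlRatio, gradedVar, map_mul, h1, map_div₀, map_sub]
  rw [← mul_sub, mul_left_comm, ← mul_sub, mul_div_mul_left _ _ hX]

variable {x}

lemma gradedVar_injective (hx : Function.Injective x) : Function.Injective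
    (fun k => algebraMap F⟦X⟧ (FractionRing F⟦X⟧) (gradedVar x k)) := by
  intro i j h
  have h1 := IsFractionRing.injective F⟦X⟧ (FractionRing F⟦X⟧) h
  exact hx (C_injective (mul_left_cancel₀ X_ne_zero h1))

lemma gradedVar_ne_zero (hx0 : ∀ i, x i ≠ 0) (i : ι) :
    algebraMap F⟦X⟧ (FractionRing F⟦X⟧) (gradedVar x i) ≠ 0 := by
  rw [Ne, IsFractionRing.to_map_eq_zero_iff]
  exact mul_ne_zero X_ne_zero fun h => hx0 i (C_injective (h.trans (map_zero C).symm))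

variable (x)

lemma constantCoeff_gradedVar (i : ι) : constantCoeff (gradedVar x i) = 0 := by
  simp [gradedVar]

lemma gradedVar_ne_one (i : ι) :
    algebraMap F⟦X⟧ (FractionRing F⟦X⟧) (gradedVar x i) ≠ 1 := by
  rw [← map_one (algebraMap F⟦X⟧ (FractionRing F⟦X⟧))]
  intro h
  have h1 := congrArg constantCoeff (IsFractionRing.injective F⟦X⟧ (FractionRing F⟦X⟧) h)
  simp [gradedVar] at h1

lemma gradedVar_mul_ne_one (i j : ι) :
    algebraMap F⟦X⟧ (FractionRing F⟦X⟧) (gradedVar x i) *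
      algebraMap F⟦X⟧ (FractionRing F⟦X⟧) (gradedVar x j) ≠ 1 := by
  rw [← map_one (algebraMap F⟦X⟧ (FractionRing F⟦X⟧)), ← map_mul]
  intro h
  have h1 := congrArg constantCoeff (IsFractionRing.injective F⟦X⟧ (FractionRing F⟦X⟧) h)
  simp [gradedVar] at h1

end FractionField

variable [LinearOrder ι]

/-- The operator that splits off the lowest block `Y \ S` of a set `Y` of variables, with a weight
depending on the size of the block. -/
noncomputable def splitOff (t : F) (x : ι → F) (w : ℕ → F) (φ : Finset ι → F⟦X⟧) (Y : Finset ι) :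
    F⟦X⟧ :=
  ∑ S ∈ Y.powerset, C (w (Y \ S).card * crossProd (hlRatio t x) S (Y \ S)) * φ S

/-- Sums over chains `R ⊆ S ⊆ Y`, indexed by `S` or by `T = S \ R`. -/
lemma sum_powerset_powerset {M : Type*} [AddCommMonoid M] (Y : Finset ι)
    (f : Finset ι → Finset ι → M) :
    ∑ S ∈ Y.powerset, ∑ R ∈ S.powerset, f S R =
      ∑ R ∈ Y.powerset, ∑ T ∈ (Y \ R).powerset, f (R ∪ T) R := by
  rw [Finset.sum_sigma', Finset.sum_sigma']
  refine Finset.sum_bij' (fun p _ => ⟨p.2, p.1 \ p.2⟩) (fun p _ => ⟨p.1 ∪ p.2, p.1⟩) ?_ ?_ ?_ ?_ ?_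
  · rintro ⟨S, R⟩ h
    simp only [Finset.mem_sigma, Finset.mem_powerset] at h ⊢
    exact ⟨h.2.trans h.1, Finset.sdiff_subset_sdiff h.1 le_rfl⟩
  · rintro ⟨R, T⟩ h
    simp only [Finset.mem_sigma, Finset.mem_powerset] at h ⊢
    exact ⟨Finset.union_subset h.1 (h.2.trans Finset.sdiff_subset), Finset.subset_union_left⟩
  · rintro ⟨S, R⟩ h
    simp only [Finset.mem_sigma, Finset.mem_powerset] at h
    simp only [Finset.union_sdiff_of_subset h.2]
  · rintro ⟨R, T⟩ h
    simp only [Finset.mem_sigma, Finset.mem_powerset] at h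
    have : (R ∪ T) \ R = T := by
      rw [Finset.union_sdiff_left, Finset.sdiff_eq_self_iff_disjoint]
      exact (Finset.subset_sdiff.mp h.2).2
    simp only [this]
  · rintro ⟨S, R⟩ h
    simp only [Finset.mem_sigma, Finset.mem_powerset] at h
    simp only [Finset.union_sdiff_of_subset h.2]

lemma sdiff_union_eq (Y R T : Finset ι) : Y \ (R ∪ T) = (Y \ R) \ T := by
  ext i; simp only [Finset.mem_sdiff, Finset.mem_union]; tauto

/-- Splitting off two blocks of variables that carry the same exponent. -/
lemma splitOff_splitOff {t : F} (ht : ∀ m : ℕ, 0 < m → t ^ m ≠ 1) {x : ι → F}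
    (hx : Function.Injective x) (hx0 : ∀ i, x i ≠ 0) (p q : F) (φ : Finset ι → F⟦X⟧) :
    splitOff t x (p ^ ·) (splitOff t x (q ^ ·) φ) =
      splitOff t x (fun m => homRS t m p q) φ := by
  funext Y
  simp only [splitOff, Finset.mul_sum]
  rw [sum_powerset_powerset Y fun S R => C (p ^ (Y \ S).card * crossProd (hlRatio t x) S (Y \ S)) *
    (C (q ^ (S \ R).card * crossProd (hlRatio t x) R (S \ R)) * φ R)]
  refine Finset.sum_congr rfl fun R hR => ?_
  rw [← sum_crossProd_eq_homRS ht x hx hx0 (Y \ R) p q, Finset.sum_mul, map_sum, Finset.sum_mul]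
  refine Finset.sum_congr rfl fun T hT => ?_
  have hT' := Finset.mem_powerset.mp hT
  have hd : Disjoint R T := (Finset.subset_sdiff.mp hT').2.symm
  have e1 : (R ∪ T) \ R = T := by
    rw [Finset.union_sdiff_left, Finset.sdiff_eq_self_iff_disjoint]
    exact hd.symm
  have e2 : crossProd (hlRatio t x) R (Y \ R) =
      crossProd (hlRatio t x) R ((Y \ R) \ T) * crossProd (hlRatio t x) R T := by
    rw [← crossProd_union_right _ _ Finset.sdiff_disjoint, Finset.sdiff_union_of_subset hT']
  rw [e1, e2, sdiff_union_eq, crossProd_union_left _ _ hd, ← mul_assoc, ← map_mul]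
  congr 2
  ring

lemma sum_prod_gradedVar (t : F) {x : ι → F} (hx : Function.Injective x) (hx0 : ∀ i, x i ≠ 0)
    (Y : Finset ι) (b : F) :
    ∑ S ∈ Y.powerset, (∏ i ∈ S, C b * gradedVar x i) * C (crossProd (hlRatio t x) S (Y \ S)) =
      ∏ i ∈ Y, (1 + C b * gradedVar x i) := by
  apply IsFractionRing.injective F⟦X⟧ (FractionRing F⟦X⟧)
  have := sum_crossProd_eq_prod_one_add (t := algebraMap F⟦X⟧ (FractionRing F⟦X⟧) (C t)) _
    (gradedVar_injective hx) (gradedVar_ne_zero hx0) Y (algebraMap _ _ (C b))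
  simp only [funext₂ (hlRatio_gradedVar t x)] at this
  simpa only [map_sum, map_mul, map_prod, map_add, map_one, map_crossProd] using this

/-- The Pieri formula for the product of all `1 + b x_i`, in operator form. -/
lemma mulElem_splitOff_mulVars (t : F) {x : ι → F} (hx : Function.Injective x)
    (hx0 : ∀ i, x i ≠ 0) (p b : F) (φ : Finset ι → F⟦X⟧) :
    mulElem x b (splitOff t x (p ^ ·) (mulVars x φ)) =
      splitOff t x (p ^ ·) (mulVars x (splitOff t x ((p * b) ^ ·) (mulElem x b φ))) := by
  funext Y
  simp only [mulElem, splitOff, mulVars, Finset.mul_sum]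
  rw [sum_powerset_powerset Y fun S R => C (p ^ (Y \ S).card * crossProd (hlRatio t x) S (Y \ S)) *
    ((∏ i ∈ S, gradedVar x i) * (C ((p * b) ^ (S \ R).card * crossProd (hlRatio t x) R (S \ R)) *
      ((∏ i ∈ R, (1 + C b * gradedVar x i)) * φ R)))]
  refine Finset.sum_congr rfl fun R hR => ?_
  rw [← Finset.prod_sdiff (Finset.mem_powerset.mp hR),
    ← sum_prod_gradedVar t hx hx0 (Y \ R) b, Finset.sum_mul, Finset.sum_mul]
  refine Finset.sum_congr rfl fun T hT => ?_
  have hT' := Finset.mem_powerset.mp hT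
  have hd : Disjoint R T := (Finset.subset_sdiff.mp hT').2.symm
  have e1 : (R ∪ T) \ R = T := by
    rw [Finset.union_sdiff_left, Finset.sdiff_eq_self_iff_disjoint]
    exact hd.symm
  have e2 : crossProd (hlRatio t x) R (Y \ R) =
      crossProd (hlRatio t x) R ((Y \ R) \ T) * crossProd (hlRatio t x) R T := by
    rw [← crossProd_union_right _ _ Finset.sdiff_disjoint, Finset.sdiff_union_of_subset hT']
  have e3 : (Y \ R).card = ((Y \ R) \ T).card + T.card := by
    rw [Finset.card_sdiff_add_card_eq_card hT']
  rw [e1, e2, e3, sdiff_union_eq, crossProd_union_left _ _ hd, Finset.prod_union hd,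
    Finset.prod_mul_distrib, Finset.prod_const, pow_add, mul_pow]
  simp only [map_mul, map_pow]
  ring

/-! ### Uniqueness of solutions of the recursions -/

/-- Two families of series agree modulo `X ^ k`, and exactly at the empty set. -/
def AgreeMod (k : ℕ) (φ ψ : Finset ι → F⟦X⟧) : Prop :=
  φ ∅ = ψ ∅ ∧ ∀ Y, (X : F⟦X⟧) ^ k ∣ φ Y - ψ Y

omit [LinearOrder ι] in
lemma AgreeMod.mulVars {k : ℕ} {φ ψ : Finset ι → F⟦X⟧} (h : AgreeMod k φ ψ) (x : ι → F) :
    AgreeMod (k + 1) (mulVars x φ) (mulVars x ψ) := by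
  refine ⟨by simp [HallLittlewood.mulVars, h.1], fun Y => ?_⟩
  simp only [HallLittlewood.mulVars, ← mul_sub]
  rcases Y.eq_empty_or_nonempty with rfl | ⟨i, hi⟩
  · simp [h.1]
  · rw [pow_succ']
    refine mul_dvd_mul ?_ (h.2 Y)
    exact (Dvd.intro _ rfl : (X : F⟦X⟧) ∣ gradedVar x i).trans (Finset.dvd_prod_of_mem _ hi)

lemma AgreeMod.splitOff {k : ℕ} {φ ψ : Finset ι → F⟦X⟧} (h : AgreeMod k φ ψ) (t : F) (x : ι → F)
    (w : ℕ → F) : AgreeMod k (splitOff t x w φ) (splitOff t x w ψ) := by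
  refine ⟨by simp [HallLittlewood.splitOff, h.1], fun Y => ?_⟩
  simp only [HallLittlewood.splitOff, ← Finset.sum_sub_distrib, ← mul_sub]
  exact Finset.dvd_sum fun S _ => (h.2 S).mul_left _

/-- The recursion with two blocks has at most one solution with given value at the empty set. -/
lemma eq_of_recursion (t : F) (x : ι → F) (u v w : ℕ → F) {φ ψ : Finset ι → F⟦X⟧}
    (hφ : φ = splitOff t x u (mulVars x (splitOff t x v (mulVars x (splitOff t x w φ)))))
    (hψ : ψ = splitOff t x u (mulVars x (splitOff t x v (mulVars x (splitOff t x w ψ)))))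
    (h0 : φ ∅ = ψ ∅) : φ = ψ := by
  have h : ∀ k, AgreeMod k φ ψ := by
    intro k
    induction k with
    | zero => exact ⟨h0, fun Y => by simp⟩
    | succ k ih =>
      have h2 := ((((ih.splitOff t x w).mulVars x).splitOff t x v).mulVars x).splitOff t x u
      rw [← hφ, ← hψ] at h2
      exact ⟨h0, fun Y => (pow_dvd_pow _ (by omega)).trans (h2.2 Y)⟩
  funext Y
  ext n
  have := X_pow_dvd_iff.mp ((h (n + 1)).2 Y) n n.lt_succ_self
  rwa [map_sub, sub_eq_zero] at this

/-! ### The product side -/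

lemma sum_littlewoodWeight_gradedVar (t : F) {x : ι → F} (hx : Function.Injective x)
    (hx0 : ∀ i, x i ≠ 0) (Y : Finset ι) :
    ∑ S ∈ Y.powerset, littlewoodWeight (C t) (gradedVar x) S (Y \ S) *
        C (crossProd (hlRatio t x) S (Y \ S)) =
      pairProd (fun i j => 1 - C t * gradedVar x i * gradedVar x j) Y := by
  apply IsFractionRing.injective F⟦X⟧ (FractionRing F⟦X⟧)
  have := sum_littlewoodWeight (t := algebraMap F⟦X⟧ (FractionRing F⟦X⟧) (C t)) _
    (gradedVar_injective hx) (gradedVar_ne_zero hx0) (gradedVar_ne_one x)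
    (gradedVar_mul_ne_one x) Y
  simp only [funext₂ (hlRatio_gradedVar t x)] at this
  simpa only [littlewoodWeight, map_sum, map_mul, map_prod, map_sub, map_one, map_crossProd,
    map_pairProd] using this

/-- The recursion `L = ∑_S …` for `L = ∏ 1 / (1 - x_i) * ∏ (1 - t x_i x_j) / (1 - x_i x_j)`. -/
lemma littlewood_recursion (t : F) {x : ι → F} (hx : Function.Injective x) (hx0 : ∀ i, x i ≠ 0)
    (L : Finset ι → F⟦X⟧)
    (hL : ∀ Y, L Y * ((∏ i ∈ Y, (1 - gradedVar x i)) *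
      pairProd (fun i j => 1 - gradedVar x i * gradedVar x j) Y) =
      pairProd (fun i j => 1 - C t * gradedVar x i * gradedVar x j) Y) :
    L = splitOff t x (1 ^ ·) (mulVars x L) := by
  have hunit : ∀ Y : Finset ι, (∏ i ∈ Y, (1 - gradedVar x i)) *
      pairProd (fun i j => 1 - gradedVar x i * gradedVar x j) Y ≠ 0 := by
    intro Y h
    have := congrArg constantCoeff h
    simp [pairProd, apply_ite constantCoeff, constantCoeff_gradedVar] at this
  funext Y
  apply mul_right_cancel₀ (hunit Y)
  rw [hL, ← sum_littlewoodWeight_gradedVar t hx hx0, splitOff, Finset.sum_mul]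
  refine Finset.sum_congr rfl fun S hS => ?_
  have hS' := Finset.mem_powerset.mp hS
  have e1 : pairProd (fun i j => 1 - gradedVar x i * gradedVar x j) Y =
      pairProd (fun i j => 1 - gradedVar x i * gradedVar x j) S *
      pairProd (fun i j => 1 - gradedVar x i * gradedVar x j) (Y \ S) *
      crossProd (fun i j => 1 - gradedVar x i * gradedVar x j) S (Y \ S) := by
    rw [← pairProd_union (fun i j => by ring) Finset.disjoint_sdiff,
      Finset.union_sdiff_of_subset hS']
  rw [littlewoodWeight, mulVars, e1, ← Finset.prod_sdiff hS', ← hL S, one_pow, one_mul]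
  ring

/-- A family of series that satisfies the recursion of the weighted sums of Hall–Littlewood
polynomials equals the product side. -/
theorem recursion_solution {t : F} (ht : ∀ m : ℕ, 0 < m → t ^ m ≠ 1) {x : ι → F}
    (hx : Function.Injective x) (hx0 : ∀ i, x i ≠ 0) (a b : F) (W U V : Finset ι → F⟦X⟧)
    (hW : W = splitOff t x (1 ^ ·) (mulVars x U))
    (hU : U = splitOff t x (fun m => homRS t m a b) (mulVars x V))
    (hV : V = splitOff t x (fun m => homRS t m 1 (a * b)) (mulVars x U))
    (hW0 : W ∅ = 1) (Y : Finset ι) :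
    W Y * ((∏ i ∈ Y, ((1 - gradedVar x i) * (1 + gradedVar x i))) *
        pairProd (fun i j => 1 - gradedVar x i * gradedVar x j) Y) =
      (∏ i ∈ Y, ((1 + C a * gradedVar x i) * (1 + C b * gradedVar x i))) *
        pairProd (fun i j => 1 - C t * gradedVar x i * gradedVar x j) Y := by
  let D : Finset ι → F⟦X⟧ := fun Y => (∏ i ∈ Y, ((1 - gradedVar x i) * (1 + gradedVar x i))) *
    pairProd (fun i j => 1 - gradedVar x i * gradedVar x j) Y
  have hD : ∀ Y, constantCoeff (D Y) ≠ 0 := fun Y => by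
    simp [D, pairProd, apply_ite constantCoeff, constantCoeff_gradedVar]
  -- `E` is the sum of the Hall–Littlewood polynomials of the partitions with even parts
  let E : Finset ι → F⟦X⟧ := fun Y =>
    pairProd (fun i j => 1 - C t * gradedVar x i * gradedVar x j) Y * (D Y)⁻¹
  have hED : ∀ Y, E Y * D Y = pairProd (fun i j => 1 - C t * gradedVar x i * gradedVar x j) Y :=
    fun Y => by
      simp only [E]
      rw [mul_assoc, PowerSeries.inv_mul_cancel _ (hD Y), mul_one]
  have hL := littlewood_recursion t hx hx0 (mulElem x 1 E) fun Y => by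
    rw [← hED Y]
    simp only [mulElem, D, map_one, one_mul, Finset.prod_mul_distrib]
    ring
  have hE : E = splitOff t x (1 ^ ·) (mulVars x (mulVars x E)) := by
    have h : mulElem x 1 E = mulElem x 1 (splitOff t x (1 ^ ·) (mulVars x (mulVars x E))) := by
      rw [mulElem_splitOff_mulVars t hx hx0, mulElem_mulVars, mul_one, ← hL]
      exact hL
    funext Y
    refine mul_left_cancel₀ (a := ∏ i ∈ Y, (1 + C 1 * gradedVar x i)) (fun h0 => ?_)
      (congrFun h Y)
    have := congrArg constantCoeff h0
    simp [constantCoeff_gradedVar] at this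
  have hb : mulElem x b E = splitOff t x (1 ^ ·) (mulVars x (splitOff t x (b ^ ·)
      (mulVars x (mulElem x b E)))) := by
    conv_lhs => rw [hE]
    rw [mulElem_splitOff_mulVars t hx hx0, mulElem_mulVars, one_mul]
  have hab : mulElem x a (mulElem x b E) = splitOff t x (1 ^ ·) (mulVars x
      (splitOff t x (fun m => homRS t m a b) (mulVars x
        (splitOff t x ((a * b) ^ ·) (mulElem x a (mulElem x b E)))))) := by
    conv_lhs => rw [hb]
    rw [mulElem_splitOff_mulVars t hx hx0, mulElem_splitOff_mulVars t hx hx0, one_mul,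
      splitOff_splitOff ht hx hx0, mul_comm b a]
  have hVW : V = splitOff t x ((a * b) ^ ·) W := by
    rw [hV, hW, splitOff_splitOff ht hx hx0]
    simp only [homRS_comm ht _ 1]
  have hWE : W = mulElem x a (mulElem x b E) := by
    refine eq_of_recursion t x _ _ _ ?_ hab ?_
    · conv_lhs => rw [hW, hU, hVW]
    · have h0 := hED ∅
      simp only [D, Finset.prod_empty, pairProd_empty, mul_one] at h0
      simp [hW0, mulElem, h0]
  rw [hWE]
  have h1 := hED Y
  simp only [D] at h1
  simp only [mulElem, Finset.prod_mul_distrib] at h1 ⊢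
  linear_combination (∏ i ∈ Y, (1 + C a * gradedVar x i)) *
    (∏ i ∈ Y, (1 + C b * gradedVar x i)) * h1

end Operators

/-! ### Weighted sums over exponent sequences -/

section ExponentSums

open PowerSeries

variable {ι F : Type*} [LinearOrder ι] [Field F]

/-- The summand `x ^ f * ∏_{f_i > f_j} (x_i - t x_j) / (x_i - x_j)` of a Hall–Littlewood
polynomial, for the variables in `Y`. -/
noncomputable def exponentTerm (t : F) (x : ι → F) (Y : Finset ι) (f : ι → ℕ) : F :=
  (∏ i ∈ Y, x i ^ f i) * ∏ i ∈ Y, ∏ j ∈ Y, if f j < f i then hlRatio t x i j else 1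

/-- The product over all values `k` of the weights `w k m`, where `m` is the number of the indices
in `Y` at which the sequence `f` has the value `k`. -/
def blockWeight (w : ℕ → ℕ → F) (Y : Finset ι) (f : ι → ℕ) : F :=
  ∏ k ∈ Y.image f, w k {i ∈ Y | f i = k}.card

omit [LinearOrder ι] in
lemma blockWeight_eq_prod {w : ℕ → ℕ → F} (hw : ∀ k, w k 0 = 1) {Y : Finset ι} {f : ι → ℕ}
    {A : Finset ℕ} (hA : Y.image f ⊆ A) :
    blockWeight w Y f = ∏ k ∈ A, w k {i ∈ Y | f i = k}.card := by
  refine Finset.prod_subset hA fun k _ hk => ?_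
  rw [Finset.filter_eq_empty_iff.mpr, Finset.card_empty, hw]
  exact fun i hi e => hk (Finset.mem_image.mpr ⟨i, hi, e⟩)

/-- The generating series of all exponent sequences on `Y`, weighted by the sizes of their
blocks. -/
noncomputable def exponentSeries (t : F) (x : ι → F) (w : ℕ → ℕ → F) (Y : Finset ι) : F⟦X⟧ :=
  PowerSeries.mk fun d => ∑ f ∈ Finset.piAntidiag Y d, blockWeight w Y f * exponentTerm t x Y f

/-- The exponent sequence that is `g + 1` on `S` and `0` elsewhere. -/
def raise (S : Finset ι) (g : ι → ℕ) (i : ι) : ℕ := if i ∈ S then g i + 1 else 0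

lemma blockWeight_raise {w : ℕ → ℕ → F} (hw : ∀ k, w k 0 = 1) {S Y : Finset ι} (h : S ⊆ Y)
    (g : ι → ℕ) : blockWeight w Y (raise S g) =
      w 0 (Y \ S).card * blockWeight (fun k => w (k + 1)) S g := by
  obtain ⟨N, hN⟩ : ∃ N, S.image g ⊆ Finset.range N := (S.image g).exists_nat_subset_range
  have hN' : Y.image (raise S g) ⊆ Finset.range (N + 1) := by
    intro k hk
    obtain ⟨i, -, rfl⟩ := Finset.mem_image.mp hk
    rw [Finset.mem_range, raise]
    split_ifs with hi
    · have := Finset.mem_range.mp (hN (Finset.mem_image_of_mem g hi))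
      omega
    · omega
  rw [blockWeight_eq_prod hw hN', blockWeight_eq_prod (fun k => hw (k + 1)) hN,
    Finset.prod_range_succ', mul_comm]
  congr 1
  · congr 2
    ext i
    simp only [Finset.mem_sdiff, raise]
    grind
  · refine Finset.prod_congr rfl fun k _ => ?_
    congr 2
    ext i
    simp only [Finset.mem_filter, raise]
    have := @h i
    grind

lemma exponentTerm_raise (t : F) (x : ι → F) {S Y : Finset ι} (h : S ⊆ Y) (g : ι → ℕ) :
    exponentTerm t x Y (raise S g) =
      crossProd (hlRatio t x) S (Y \ S) * ((∏ i ∈ S, x i) * exponentTerm t x S g) := by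
  have e1 : ∏ i ∈ Y, x i ^ raise S g i = (∏ i ∈ S, x i) * ∏ i ∈ S, x i ^ g i := by
    rw [← Finset.prod_sdiff h, Finset.prod_eq_one, one_mul, ← Finset.prod_mul_distrib]
    · exact Finset.prod_congr rfl fun i hi => by rw [raise, if_pos hi, pow_succ']
    · intro i hi
      rw [raise, if_neg (Finset.mem_sdiff.mp hi).2, pow_zero]
  have e2 : (∏ i ∈ Y, ∏ j ∈ Y, if raise S g j < raise S g i then hlRatio t x i j else 1) =
      crossProd (hlRatio t x) S (Y \ S) *
        ∏ i ∈ S, ∏ j ∈ S, if g j < g i then hlRatio t x i j else 1 := by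
    rw [← Finset.prod_sdiff h, Finset.prod_eq_one, one_mul, crossProd,
      ← Finset.prod_mul_distrib]
    · refine Finset.prod_congr rfl fun i hi => ?_
      rw [← Finset.prod_sdiff h]
      congr 1
      · refine Finset.prod_congr rfl fun j hj => ?_
        rw [if_pos]
        simp [raise, hi, (Finset.mem_sdiff.mp hj).2]
      · refine Finset.prod_congr rfl fun j hj => ?_
        simp [raise, hi, hj]
    · intro i hi
      refine Finset.prod_eq_one fun j _ => ?_
      rw [if_neg]
      simp [raise, (Finset.mem_sdiff.mp hi).2]
  rw [exponentTerm, e1, e2, exponentTerm]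
  ring

/-- Splitting an exponent sequence into its zero set and the sequence of its nonzero entries. -/
theorem exponentSeries_recursion (t : F) (x : ι → F) {w : ℕ → ℕ → F} (hw : ∀ k, w k 0 = 1) :
    exponentSeries t x w =
      splitOff t x (w 0) (mulVars x (exponentSeries t x fun k => w (k + 1))) := by
  funext Y
  ext d
  rw [exponentSeries, coeff_mk, splitOff, map_sum,
    ← Finset.sum_fiberwise_of_maps_to (s := Finset.piAntidiag Y d) (t := Y.powerset)
      (g := fun f => {i ∈ Y | f i ≠ 0})
      (fun f _ => Finset.mem_powerset.mpr (Finset.filter_subset _ _))]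
  refine Finset.sum_congr rfl fun S hS => ?_
  have hS' := Finset.mem_powerset.mp hS
  have e1 : ∏ i ∈ S, gradedVar x i = X ^ S.card * C (∏ i ∈ S, x i) := by
    simp only [gradedVar, Finset.prod_mul_distrib, Finset.prod_const, map_prod]
  rw [coeff_C_mul, mulVars, e1, mul_assoc (X ^ _), coeff_X_pow_mul', coeff_C_mul,
    exponentSeries, coeff_mk]
  split_ifs with hd
  · rw [Finset.mul_sum, Finset.mul_sum]
    symm
    refine Finset.sum_bij' (fun g _ => raise S g) (fun f _ i => f i - 1) ?_ ?_ ?_ ?_ ?_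
    · intro g hg
      rw [Finset.mem_piAntidiag] at hg
      rw [Finset.mem_filter, Finset.mem_piAntidiag]
      refine ⟨⟨?_, fun i hi => ?_⟩, ?_⟩
      · rw [← Finset.sum_sdiff hS', Finset.sum_eq_zero, zero_add]
        · have : ∑ i ∈ S, raise S g i = S.sum g + S.card := by
            rw [Finset.card_eq_sum_ones, ← Finset.sum_add_distrib]
            exact Finset.sum_congr rfl fun i hi => by rw [raise, if_pos hi]
          omega
        · intro i hi
          rw [raise, if_neg (Finset.mem_sdiff.mp hi).2]
      · simp only [raise, ne_eq, ite_eq_right_iff, Nat.succ_ne_zero, imp_false, not_not] at hi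
        exact hS' hi
      · ext i
        simp only [raise]
        have := @hS' i
        grind
    · intro f hf
      rw [Finset.mem_filter, Finset.mem_piAntidiag] at hf
      obtain ⟨⟨h1, h2⟩, rfl⟩ := hf
      rw [Finset.mem_piAntidiag]
      constructor
      · rw [← h1, ← Finset.sum_filter_add_sum_filter_not Y (fun i => f i ≠ 0) f,
          Finset.sum_eq_zero (s := {i ∈ Y | ¬ f i ≠ 0}), add_zero]
        · refine Nat.eq_sub_of_add_eq ?_
          rw [Finset.card_eq_sum_ones, ← Finset.sum_add_distrib]
          refine Finset.sum_congr rfl fun i hi => ?_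
          have := (Finset.mem_filter.mp hi).2
          omega
        · intro i hi
          exact not_not.mp (Finset.mem_filter.mp hi).2
      · intro i hi
        have : f i ≠ 0 := by omega
        exact Finset.mem_filter.mpr ⟨h2 i this, this⟩
    · intro g hg
      rw [Finset.mem_piAntidiag] at hg
      funext i
      simp only [raise]
      split_ifs with hi
      · rfl
      · by_contra h
        exact hi (hg.2 i (Ne.symm h))
    · intro f hf
      rw [Finset.mem_filter, Finset.mem_piAntidiag] at hf
      obtain ⟨⟨h1, h2⟩, rfl⟩ := hf
      funext i
      simp only [raise, Finset.mem_filter]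
      have := h2 i
      split_ifs with hi
      · omega
      · by_contra h
        exact hi ⟨this (Ne.symm h), Ne.symm h⟩
    · intro g _
      rw [blockWeight_raise hw hS', exponentTerm_raise t x hS']
      ring
  · rw [mul_zero]
    refine Finset.sum_eq_zero fun f hf => ?_
    rw [Finset.mem_filter, Finset.mem_piAntidiag] at hf
    obtain ⟨⟨h1, h2⟩, rfl⟩ := hf
    refine absurd ?_ hd
    rw [← h1, Finset.card_eq_sum_ones]
    refine (Finset.sum_le_sum fun i hi => ?_).trans
      (Finset.sum_le_sum_of_subset (Finset.filter_subset _ _))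
    exact Nat.one_le_iff_ne_zero.mpr (Finset.mem_filter.mp hi).2

/-- The block weights of the Rogers–Szegő polynomials; the zero entries carry no weight. -/
noncomputable def rsWeight (t a b : F) (k m : ℕ) : F :=
  if k = 0 then 1 else if Even k then homRS t m 1 (a * b) else homRS t m a b

/-- The product formula for the sum over exponent sequences with Rogers–Szegő weights. -/
theorem exponentSeries_rsWeight {t : F} (ht : ∀ m : ℕ, 0 < m → t ^ m ≠ 1) {x : ι → F}
    (hx : Function.Injective x) (hx0 : ∀ i, x i ≠ 0) (a b : F) (Y : Finset ι) :
    exponentSeries t x (rsWeight t a b) Y *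
        ((∏ i ∈ Y, ((1 - gradedVar x i) * (1 + gradedVar x i))) *
        pairProd (fun i j => 1 - gradedVar x i * gradedVar x j) Y) =
      (∏ i ∈ Y, ((1 + C a * gradedVar x i) * (1 + C b * gradedVar x i))) *
        pairProd (fun i j => 1 - C t * gradedVar x i * gradedVar x j) Y := by
  have hw : ∀ k, rsWeight t a b k 0 = 1 := fun k => by
    simp only [rsWeight, homRS_zero, ite_self]
  refine recursion_solution ht hx hx0 a b _
    (exponentSeries t x fun k => rsWeight t a b (k + 1))
    (exponentSeries t x fun k => rsWeight t a b (k + 2)) ?_ ?_ ?_ ?_ Y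
  · rw [exponentSeries_recursion t x hw]
    congr 1
    funext m
    simp [rsWeight]
  · rw [exponentSeries_recursion t x fun k => hw (k + 1)]
    congr 1
  · rw [exponentSeries_recursion t x fun k => hw (k + 2)]
    have h3 : (fun k => rsWeight t a b (k + 1 + 2)) = fun k => rsWeight t a b (k + 1) := by
      funext k m
      simp [rsWeight, Nat.even_add]
    rw [h3]
    congr 1
  · ext d
    rw [exponentSeries, coeff_mk, coeff_one]
    rcases Nat.eq_zero_or_pos d with rfl | hd
    · simp [blockWeight, exponentTerm]
    · rw [Finset.piAntidiag_empty_of_ne_zero hd.ne', Finset.sum_empty, if_neg hd.ne']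

end ExponentSums

/-! ### Exponent sequences and partitions -/

section Types

lemma ptn_ext {μ ν : Ptn} (h : μ.2.parts = ν.2.parts) : μ = ν := by
  obtain ⟨m, p⟩ := μ
  obtain ⟨k, q⟩ := ν
  obtain rfl : m = k := by rw [← p.parts_sum, ← q.parts_sum]; exact congrArg _ h
  exact congrArg (Sigma.mk m) (Nat.Partition.ext h)

lemma ofMultiset_parts {l : Multiset ℕ} (h : 0 ∉ l) : (Nat.Partition.ofMultiset l).parts = l :=
  Multiset.filter_eq_self.mpr fun _ hi e => h (e ▸ hi)

lemma evenPart_parts (μ : Ptn) : (evenPart μ).2.parts = μ.2.parts.filter fun i => Even i :=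
  ofMultiset_parts fun h => absurd (μ.2.parts_pos (Multiset.mem_of_mem_filter h)) (lt_irrefl 0)

lemma oddPart_parts (μ : Ptn) : (oddPart μ).2.parts = μ.2.parts.filter fun i => Odd i :=
  ofMultiset_parts fun h => absurd (μ.2.parts_pos (Multiset.mem_of_mem_filter h)) (lt_irrefl 0)

variable {n : ℕ}

/-- The partition formed by the nonzero entries of an exponent sequence. -/
def typ (f : Fin n → ℕ) : Ptn := ⟨_, Nat.Partition.ofMultiset (Finset.univ.val.map f)⟩

lemma typ_parts (f : Fin n → ℕ) : (typ f).2.parts = (Finset.univ.val.map f).filter (· ≠ 0) := rfl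

lemma typ_fst (f : Fin n → ℕ) : (typ f).1 = ∑ i, f i := rfl

lemma mult_typ (f : Fin n → ℕ) {k : ℕ} (hk : k ≠ 0) :
    mult (typ f) k = (Finset.univ.filter fun i => f i = k).card := by
  rw [mult, typ_parts, Multiset.count_filter_of_pos (p := (· ≠ 0)) hk, Multiset.count_map]
  simp only [eq_comm (a := k)]
  rfl

lemma len_typ_le (f : Fin n → ℕ) : len (typ f) ≤ n := by
  rw [len, typ_parts]
  refine (Multiset.card_le_card (Multiset.filter_le _ _)).trans ?_
  simp

lemma typ_comp_perm (f : Fin n → ℕ) (w : Equiv.Perm (Fin n)) : typ (fun i => f (w i)) = typ f := by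
  apply ptn_ext
  rw [typ_parts, typ_parts, show (fun i => f (w i)) = f ∘ w from rfl, ← Multiset.map_map f w]
  congr 2
  exact Multiset.map_univ_val_equiv w

lemma exists_perm_of_typ_eq {f g : Fin n → ℕ} (h : typ f = typ g) :
    ∃ w : Equiv.Perm (Fin n), ∀ i, g (w i) = f i := by
  have hk : ∀ k, k ≠ 0 → (Finset.univ.filter fun i => f i = k).card =
      (Finset.univ.filter fun i => g i = k).card := fun k hk => by
    rw [← mult_typ f hk, ← mult_typ g hk, h]
  have h0 : (Finset.univ.filter fun i => f i = 0).card =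
      (Finset.univ.filter fun i => g i = 0).card := by
    have e : ∀ u : Fin n → ℕ, (Finset.univ.filter fun i => u i = 0).card + len (typ u) = n := by
      intro u
      have e1 : len (typ u) = (Finset.univ.filter fun i => ¬ u i = 0).card := by
        rw [len, typ_parts, Multiset.filter_map, Multiset.card_map]
        rfl
      rw [e1, Finset.card_filter_add_card_filter_not, Finset.card_univ, Fintype.card_fin]
    have e1 := e f
    have e2 := e g
    rw [h] at e1
    omega
  have hc : ∀ k, Nonempty ({i // f i = k} ≃ {i // g i = k}) := fun k => by
    refine ⟨Fintype.equivOfCardEq ?_⟩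
    rw [Fintype.card_subtype, Fintype.card_subtype]
    rcases eq_or_ne k 0 with rfl | h
    · exact h0
    · exact hk k h
  let e := fun k => (hc k).some
  exact ⟨Equiv.ofFiberEquiv e, fun i => Equiv.ofFiberEquiv_map e i⟩

lemma typ_seq {μ : Ptn} (h : len μ ≤ n) : typ (seq n μ) = μ := by
  apply ptn_ext
  have hl : (μ.2.parts.sort (· ≥ ·)).length ≤ n := by rwa [Multiset.length_sort]
  have e : List.ofFn (seq n μ) = μ.2.parts.sort (· ≥ ·) ++
      List.replicate (n - (μ.2.parts.sort (· ≥ ·)).length) 0 := by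
    apply List.ext_getElem
    · rw [List.length_ofFn, List.length_append, List.length_replicate]
      omega
    · intro i h1 h2
      rw [List.getElem_ofFn, seq]
      rcases lt_or_ge i (μ.2.parts.sort (· ≥ ·)).length with h | h
      · rw [List.getElem_append_left h, List.getD_eq_getElem _ _ h]
      · rw [List.getElem_append_right h, List.getElem_replicate, List.getD_eq_default _ _ h]
  have h0 : ∀ i ∈ μ.2.parts, i ≠ 0 := fun i hi => (μ.2.parts_pos hi).ne'
  rw [typ_parts, Fin.univ_val_map, e, ← Multiset.coe_add, Multiset.sort_eq, Multiset.filter_add,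
    Multiset.filter_eq_self.mpr h0, Multiset.coe_replicate,
    Multiset.filter_eq_nil.mpr, add_zero]
  intro i hi
  simp [Multiset.eq_of_mem_replicate hi]

/-- The partitions of `d`. -/
def ptnsOf (d : ℕ) : Finset Ptn :=
  Finset.univ.map ⟨fun p : Nat.Partition d => (⟨d, p⟩ : Ptn), sigma_mk_injective⟩

lemma mem_ptnsOf {d : ℕ} {μ : Ptn} : μ ∈ ptnsOf d ↔ μ.1 = d := by
  obtain ⟨m, p⟩ := μ
  simp only [ptnsOf, Finset.mem_map, Finset.mem_univ, true_and, Function.Embedding.coeFn_mk]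
  constructor
  · rintro ⟨q, hq⟩
    exact (congrArg Sigma.fst hq).symm
  · rintro rfl
    exact ⟨p, rfl⟩

lemma orbitSeq_injective (v : Fin n → ℕ) : Function.Injective (orbitSeq v) := by
  intro p q
  induction p using Quotient.inductionOn' with
  | h w =>
    induction q using Quotient.inductionOn' with
    | h u =>
      intro h
      refine Quotient.sound' (QuotientGroup.leftRel_apply.mpr fun i => ?_)
      have := congrFun h (u i)
      simpa [orbitSeq] using this

lemma typ_orbitSeq (v : Fin n → ℕ) (q : Equiv.Perm (Fin n) ⧸ stab v) :
    typ (orbitSeq v q) = typ v := by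
  induction q using Quotient.inductionOn' with
  | h w => exact typ_comp_perm v w⁻¹

lemma exists_orbitSeq_eq {v f : Fin n → ℕ} (h : typ f = typ v) :
    ∃ q : Equiv.Perm (Fin n) ⧸ stab v, orbitSeq v q = f := by
  obtain ⟨w, hw⟩ := exists_perm_of_typ_eq h
  refine ⟨Quotient.mk'' w⁻¹, ?_⟩
  funext i
  change v (w⁻¹⁻¹ i) = f i
  rw [inv_inv, hw]

end Types

/-! ### The coefficients of the partitions -/

section Coefficients

variable {K : Type*} [Field K]

/-- The coefficient of `P_μ` in the sum side. -/
noncomputable def ptnCoeff (a b t : K) (μ : Ptn) : K :=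
  a ^ len (oddPart μ) * hPtn (evenPart μ) (a * b) t * hPtn (oddPart μ) (b / a) t

lemma ptnCoeff_eq_prod {a : K} (ha : a ≠ 0) (b t : K) (μ : Ptn) :
    ptnCoeff a b t μ = ∏ k ∈ μ.2.parts.toFinset, rsWeight t a b k (mult μ k) := by
  have hpos : ∀ k ∈ μ.2.parts.toFinset, k ≠ 0 := fun k hk =>
    (μ.2.parts_pos (Multiset.mem_toFinset.mp hk)).ne'
  have h1 : hPtn (evenPart μ) (a * b) t =
      ∏ k ∈ μ.2.parts.toFinset with Even k, rsWeight t a b k (mult μ k) := by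
    rw [hPtn, evenPart_parts, Multiset.toFinset_filter]
    refine Finset.prod_congr rfl fun k hk => ?_
    have hk' := Finset.mem_filter.mp hk
    rw [mult, evenPart_parts, Multiset.count_filter_of_pos hk'.2, rsWeight,
      if_neg (hpos k hk'.1), if_pos hk'.2, homRS_one_left, mult]
  have h2 : a ^ len (oddPart μ) * hPtn (oddPart μ) (b / a) t =
      ∏ k ∈ μ.2.parts.toFinset with Odd k, rsWeight t a b k (mult μ k) := by
    rw [hPtn, len, ← Multiset.toFinset_sum_count_eq, ← Finset.prod_pow_eq_pow_sum,
      ← Finset.prod_mul_distrib, oddPart_parts, Multiset.toFinset_filter]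
    refine Finset.prod_congr rfl fun k hk => ?_
    have hk' := Finset.mem_filter.mp hk
    rw [mult, oddPart_parts, Multiset.count_filter_of_pos hk'.2, rsWeight,
      if_neg (hpos k hk'.1), if_neg (Nat.not_even_iff_odd.mpr hk'.2), homRS_eq_pow_mul ha, mult]
  rw [ptnCoeff, mul_right_comm, h2, h1,
    ← Finset.prod_filter_mul_prod_filter_not μ.2.parts.toFinset (fun k => Even k), mul_comm]
  simp only [Nat.not_even_iff_odd]

lemma blockWeight_rsWeight {n : ℕ} {a : K} (ha : a ≠ 0) (b t : K) (f : Fin n → ℕ) :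
    blockWeight (rsWeight t a b) Finset.univ f = ptnCoeff a b t (typ f) := by
  rw [ptnCoeff_eq_prod ha, blockWeight]
  symm
  have hmem : ∀ k, k ∈ (typ f).2.parts.toFinset ↔ k ∈ Finset.univ.image f ∧ k ≠ 0 := fun k => by
    rw [Multiset.mem_toFinset, typ_parts, Multiset.mem_filter]
    simp
  refine (Finset.prod_congr rfl fun k hk => ?_).trans
    (Finset.prod_subset (fun k hk => ((hmem k).mp hk).1) fun k hk hk' => ?_)
  · rw [mult_typ f ((hmem k).mp hk).2]
  · have : k = 0 := by
      by_contra h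
      exact hk' ((hmem k).mpr ⟨hk, h⟩)
    rw [rsWeight, if_pos this]

variable {F : Type*} [Field F] (φ : K →+* F)

lemma map_homRS (t : K) (m : ℕ) (p q : K) :
    homRS (φ t) m (φ p) (φ q) = φ (homRS t m p q) := by
  simp only [homRS, tBinom, shiftedFactorial, map_sum, map_mul, map_pow, apply_ite φ, map_div₀,
    map_prod, map_sub, map_one, map_zero]

lemma map_blockWeight_rsWeight (t a b : K) {ι : Type*} [LinearOrder ι] (Y : Finset ι)
    (f : ι → ℕ) : blockWeight (rsWeight (φ t) (φ a) (φ b)) Y f =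
      φ (blockWeight (rsWeight t a b) Y f) := by
  simp only [blockWeight, rsWeight, map_prod, apply_ite φ, map_one, ← map_homRS, map_mul]

end Coefficients

/-! ### Hall–Littlewood polynomials as sums over exponent sequences -/

section ExponentSumsOfPartitions

variable {K : Type*} [Field K] {n : ℕ}

lemma exponentTerm_eq_hlTerm (t : K) (f : Fin n → ℕ) :
    exponentTerm (scal n t) (xvar K) Finset.univ f = hlTerm t f 1 := by
  rw [exponentTerm, hlTerm, Finset.prod_filter, Fintype.prod_prod_type]
  rfl

/-- The Hall–Littlewood polynomial is the sum of the terms of the exponent sequences of its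
type. -/
lemma sum_exponentTerm_eq_hlPoly (t : K) {d : ℕ} {μ : Ptn} (hμ : μ.1 = d) :
    ∑ f ∈ Finset.piAntidiag Finset.univ d with typ f = μ,
        exponentTerm (scal n t) (xvar K) Finset.univ f =
      algebraMap _ (FractionRing (MvPolynomial (Fin n) K)) (hlPoly n t μ) := by
  classical
  by_cases h : len μ ≤ n
  · have : Fintype (Equiv.Perm (Fin n) ⧸ stab (seq n μ)) := Fintype.ofFinite _
    rw [algebraMap_hlPoly n t μ h, hlRational_eq]
    symm
    refine Finset.sum_bij (fun q _ => orbitSeq (seq n μ) q) ?_ ?_ ?_ ?_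
    · intro q _
      have e : typ (orbitSeq (seq n μ) q) = μ := (typ_orbitSeq _ q).trans (typ_seq h)
      rw [Finset.mem_filter, Finset.mem_piAntidiag]
      refine ⟨⟨?_, fun i _ => Finset.mem_univ i⟩, e⟩
      rw [← hμ]
      exact (typ_fst _).symm.trans (congrArg Sigma.fst e)
    · exact fun p _ q _ e => orbitSeq_injective _ e
    · intro f hf
      obtain ⟨q, hq⟩ := exists_orbitSeq_eq ((Finset.mem_filter.mp hf).2.trans (typ_seq h).symm)
      exact ⟨q, Finset.mem_univ q, hq⟩
    · exact fun q _ => (exponentTerm_eq_hlTerm t _).symm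
  · rw [hlPoly, if_neg h, map_zero]
    refine Finset.sum_eq_zero fun f hf => ?_
    exact absurd ((Finset.mem_filter.mp hf).2 ▸ len_typ_le f) h

/-- The sum side, degree by degree, as a series over exponent sequences. -/
lemma coeff_exponentSeries (a b t : K) (ha : a ≠ 0) (d : ℕ) :
    PowerSeries.coeff d (exponentSeries (scal n t) (xvar K)
        (rsWeight (scal n t) (scal n a) (scal n b)) Finset.univ) =
      algebraMap (MvPolynomial (Fin n) K) (FractionRing (MvPolynomial (Fin n) K))
        (∑ μ ∈ ptnsOf d, MvPolynomial.C (ptnCoeff a b t μ) * hlPoly n t μ) := by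
  classical
  have hw : ∀ f : Fin n → ℕ,
      blockWeight (rsWeight (scal n t) (scal n a) (scal n b)) Finset.univ f =
        scal n (ptnCoeff a b t (typ f)) := fun f =>
    (map_blockWeight_rsWeight ((algebraMap (MvPolynomial (Fin n) K)
      (FractionRing (MvPolynomial (Fin n) K))).comp MvPolynomial.C) t a b Finset.univ f).trans
      (by rw [blockWeight_rsWeight ha]; rfl)
  rw [exponentSeries, PowerSeries.coeff_mk, map_sum,
    ← Finset.sum_fiberwise_of_maps_to (s := Finset.piAntidiag Finset.univ d) (t := ptnsOf d)
      (g := typ) (fun f hf => mem_ptnsOf.mpr (Finset.mem_piAntidiag.mp hf).1)]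
  refine Finset.sum_congr rfl fun μ hμ => ?_
  rw [map_mul, ← sum_exponentTerm_eq_hlPoly t (mem_ptnsOf.mp hμ), Finset.mul_sum]
  refine Finset.sum_congr rfl fun f hf => ?_
  rw [hw, (Finset.mem_filter.mp hf).2]
  rfl

end ExponentSumsOfPartitions

/-! ### Homogenization -/

section Homogenize

variable {K : Type*} [Field K] {n : ℕ}

/-- The homogeneous component of degree `d` of a power series, as a polynomial. -/
noncomputable def degreePart (S : MvPowerSeries (Fin n) K) (d : ℕ) : MvPolynomial (Fin n) K :=
  ∑ e ∈ Finset.finsuppAntidiag Finset.univ d, MvPolynomial.monomial e (MvPowerSeries.coeff e S)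

lemma coeff_degreePart (S : MvPowerSeries (Fin n) K) (d : ℕ) (e : Fin n →₀ ℕ) :
    (degreePart S d).coeff e = if e.degree = d then MvPowerSeries.coeff e S else 0 := by
  simp only [degreePart, MvPolynomial.coeff_sum, MvPolynomial.coeff_monomial,
    Finset.sum_ite_eq', Finset.mem_finsuppAntidiag, Finset.subset_univ, and_true,
    Finsupp.degree_eq_sum]

/-- The ring homomorphism that sorts a power series by degree: it maps `x_i` to `X * x_i`. -/
noncomputable def homogenize (K : Type*) [Field K] (n : ℕ) :
    MvPowerSeries (Fin n) K →+* PowerSeries (MvPolynomial (Fin n) K) where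
  toFun S := PowerSeries.mk (degreePart S)
  map_zero' := by
    ext d e
    simp [coeff_degreePart]
  map_one' := by
    ext d e
    classical
    rw [PowerSeries.coeff_mk, coeff_degreePart, MvPowerSeries.coeff_one, PowerSeries.coeff_one,
      apply_ite (MvPolynomial.coeff e), MvPolynomial.coeff_one, MvPolynomial.coeff_zero]
    rcases eq_or_ne e 0 with rfl | he
    · simp [eq_comm]
    · simp [he, he.symm]
  map_add' S T := by
    ext d e
    simp only [map_add, PowerSeries.coeff_mk, MvPolynomial.coeff_add, coeff_degreePart]
    split_ifs <;> simp
  map_mul' S T := by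
    classical
    ext d e
    rw [PowerSeries.coeff_mk, coeff_degreePart, PowerSeries.coeff_mul, MvPolynomial.coeff_sum]
    simp only [PowerSeries.coeff_mk, MvPolynomial.coeff_mul, coeff_degreePart]
    rw [Finset.sum_comm, MvPowerSeries.coeff_mul]
    have h : ∀ p ∈ Finset.HasAntidiagonal.antidiagonal e, p.1.degree + p.2.degree = e.degree :=
        fun p hp => by
      rw [← Finset.HasAntidiagonal.mem_antidiagonal.mp hp, map_add]
    split_ifs with he
    · refine Finset.sum_congr rfl fun p hp => ?_
      rw [Finset.sum_eq_single (p.1.degree, p.2.degree)]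
      · simp
      · rintro ⟨k, l⟩ - hkl
        by_cases h1 : p.1.degree = k
        · have h2 : p.2.degree ≠ l := fun h2 => hkl (by rw [h1, h2])
          rw [if_neg h2, mul_zero]
        · rw [if_neg h1, zero_mul]
      · intro hp'
        exact absurd (Finset.HasAntidiagonal.mem_antidiagonal.mpr ((h p hp).trans he)) hp'
    · symm
      refine Finset.sum_eq_zero fun p hp => Finset.sum_eq_zero fun k hk => ?_
      by_cases h1 : p.1.degree = k.1
      · have h2 : p.2.degree ≠ k.2 := fun h2 => he (by
          rw [← h p hp, h1, h2, Finset.HasAntidiagonal.mem_antidiagonal.mp hk])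
        rw [if_neg h2, mul_zero]
      · rw [if_neg h1, zero_mul]

lemma coeff_homogenize (S : MvPowerSeries (Fin n) K) (d : ℕ) :
    PowerSeries.coeff d (homogenize K n S) = degreePart S d :=
  PowerSeries.coeff_mk d (degreePart S)

lemma homogenize_injective : Function.Injective (homogenize K n) := by
  intro S T h
  ext e
  have := congrArg (fun P => (PowerSeries.coeff e.degree P).coeff e) h
  simpa [coeff_homogenize, coeff_degreePart] using this

lemma isHomogeneous_iff_homogenize {p : MvPolynomial (Fin n) K} {d : ℕ} :
    p.IsHomogeneous d ↔
      homogenize K n (p : MvPowerSeries (Fin n) K) = PowerSeries.X ^ d * PowerSeries.C p := by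
  have hc : ∀ k, PowerSeries.coeff k (PowerSeries.X ^ d * PowerSeries.C p) =
      if k = d then p else 0 := fun k => by
    rw [PowerSeries.coeff_X_pow_mul', PowerSeries.coeff_C]
    split_ifs <;> first | rfl | omega
  constructor
  · intro h
    ext k e
    rw [coeff_homogenize, coeff_degreePart, hc, MvPolynomial.coeff_coe,
      apply_ite (MvPolynomial.coeff e), MvPolynomial.coeff_zero]
    by_cases h0 : p.coeff e = 0
    · simp [h0]
    · have : e.degree = d := by
        by_contra hne
        exact h0 (h.coeff_eq_zero hne)
      simp [this, eq_comm]
  · intro h e he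
    by_contra hne
    have h1 := congrArg (fun P => (PowerSeries.coeff e.degree P).coeff e) h
    have hne' : e.degree ≠ d := fun h2 => hne (by
      rw [← h2, Finsupp.degree_eq_weight_one]
      rfl)
    simp only [coeff_homogenize, coeff_degreePart, hc, if_true, if_neg hne',
      MvPolynomial.coeff_coe, MvPolynomial.coeff_zero] at h1
    exact he h1

/-- A factor of a homogeneous polynomial with homogeneous cofactor is homogeneous. -/
lemma isHomogeneous_of_mul {p q : MvPolynomial (Fin n) K} {d k : ℕ} (hq : q.IsHomogeneous k)
    (hq0 : q ≠ 0) (h : (q * p).IsHomogeneous (k + d)) : p.IsHomogeneous d := by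
  rw [isHomogeneous_iff_homogenize] at hq h ⊢
  have hC : PowerSeries.X ^ k * PowerSeries.C q ≠ 0 :=
    mul_ne_zero (pow_ne_zero _ PowerSeries.X_ne_zero) fun e =>
      hq0 (PowerSeries.C_injective (e.trans (map_zero PowerSeries.C).symm))
  apply mul_left_cancel₀ hC
  rw [← hq, ← map_mul, ← MvPolynomial.coe_mul, h, hq, map_mul, pow_add]
  ring

/-- The Hall–Littlewood polynomial `P_μ` is homogeneous of degree `|μ|`. -/
theorem isHomogeneous_hlPoly (t : K) (μ : Ptn) : (hlPoly n t μ).IsHomogeneous μ.1 := by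
  classical
  by_cases hl : len μ ≤ n
  swap
  · rw [hlPoly, if_neg hl]
    exact MvPolynomial.isHomogeneous_zero _ _ _
  let B : Finset (Fin n × Fin n) := Finset.univ.filter fun p => p.1 ≠ p.2
  have hsub : ∀ i j : Fin n, (MvPolynomial.X i - MvPolynomial.X j :
      MvPolynomial (Fin n) K).IsHomogeneous 1 := fun i j =>
    (MvPolynomial.isHomogeneous_X K i).sub (MvPolynomial.isHomogeneous_X K j)
  have hD : (diffProd K B).IsHomogeneous B.card := by
    rw [Finset.card_eq_sum_ones]
    exact MvPolynomial.IsHomogeneous.prod _ _ _ fun p _ => hsub p.1 p.2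
  have hD0 : diffProd K B ≠ 0 := diffProd_ne_zero fun p hp => (Finset.mem_filter.mp hp).2
  refine isHomogeneous_of_mul hD hD0 ?_
  -- the numerator of a single term over the common denominator
  let Q : (Fin n → ℕ) → MvPolynomial (Fin n) K := fun f =>
    (∏ i, MvPolynomial.X i ^ f i) * ∏ p ∈ B, if f p.2 < f p.1 then
      MvPolynomial.X p.1 - MvPolynomial.C t * MvPolynomial.X p.2 else
      MvPolynomial.X p.1 - MvPolynomial.X p.2
  have hQ : ∀ f, (Q f).IsHomogeneous (∑ i, f i + B.card) := fun f => by
    refine MvPolynomial.IsHomogeneous.mul ?_ ?_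
    · exact MvPolynomial.IsHomogeneous.prod _ _ _ fun i _ =>
        MvPolynomial.isHomogeneous_X_pow i (f i)
    · rw [Finset.card_eq_sum_ones]
      refine MvPolynomial.IsHomogeneous.prod _ _ _ fun p _ => ?_
      split_ifs
      · exact (MvPolynomial.isHomogeneous_X K p.1).sub (MvPolynomial.isHomogeneous_C_mul_X t p.2)
      · exact hsub p.1 p.2
  have hQt : ∀ f, algebraMap (MvPolynomial (Fin n) K) (FractionRing (MvPolynomial (Fin n) K)) (Q f)
      = algebraMap _ _ (diffProd K B) * hlTerm t f 1 := fun f => by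
    have e1 : (∏ p : Fin n × Fin n with f p.1 > f p.2,
        (xvar K p.1 - scal n t * xvar K p.2) / (xvar K p.1 - xvar K p.2)) =
        ∏ p ∈ B, if f p.2 < f p.1 then
          (xvar K p.1 - scal n t * xvar K p.2) / (xvar K p.1 - xvar K p.2) else 1 := by
      rw [← Finset.prod_filter]
      refine Finset.prod_congr ?_ fun _ _ => rfl
      ext p
      simp only [B, Finset.mem_filter, Finset.mem_univ, true_and, gt_iff_lt]
      exact ⟨fun h => ⟨fun e => by simp [e] at h, h⟩, fun h => h.2⟩
    simp only [hlTerm, Equiv.Perm.coe_one, id_eq]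
    rw [e1, diffProd, map_prod, mul_left_comm, ← Finset.prod_mul_distrib]
    simp only [Q, map_mul, map_prod, map_pow]
    congr 1
    refine Finset.prod_congr rfl fun p hp => ?_
    have hne := xvar_sub_ne_zero (K := K) (Finset.mem_filter.mp hp).2
    simp only [map_sub, map_mul, apply_ite (algebraMap (MvPolynomial (Fin n) K)
      (FractionRing (MvPolynomial (Fin n) K)))]
    change (if f p.2 < f p.1 then xvar K p.1 - scal n t * xvar K p.2 else
      xvar K p.1 - xvar K p.2) = (xvar K p.1 - xvar K p.2) * _
    split_ifs
    · rw [mul_div_cancel₀ _ hne]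
    · rw [mul_one]
  have : Fintype (Equiv.Perm (Fin n) ⧸ stab (seq n μ)) := Fintype.ofFinite _
  have hsum : diffProd K B * hlPoly n t μ =
      ∑ q : Equiv.Perm (Fin n) ⧸ stab (seq n μ), Q (orbitSeq (seq n μ) q) := by
    apply IsFractionRing.injective (MvPolynomial (Fin n) K)
      (FractionRing (MvPolynomial (Fin n) K))
    rw [map_mul, algebraMap_hlPoly n t μ hl, hlRational_eq, map_sum, Finset.mul_sum]
    exact Finset.sum_congr rfl fun q _ => (hQt _).symm
  rw [hsum]
  refine MvPolynomial.IsHomogeneous.sum _ _ _ fun q _ => ?_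
  have h1 := congrArg Sigma.fst ((typ_orbitSeq (seq n μ) q).trans (typ_seq hl))
  rw [typ_fst] at h1
  rw [add_comm, ← h1]
  exact hQ _

end Homogenize

/-! ### The identity in finitely many variables -/

section FiniteIdentity

variable {K : Type*} [Field K] {n : ℕ}

/-- The sum side as a power series; the coefficient of a monomial of degree `d` only involves the
partitions of `d`. -/
noncomputable def sumSide (n : ℕ) (a b t : K) : MvPowerSeries (Fin n) K := fun e =>
  ∑ μ ∈ ptnsOf e.degree, ptnCoeff a b t μ * (hlPoly n t μ).coeff e

/-- The embedding of power series into the power series over the rational functions that maps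
`x_i` to `X * x_i`. -/
noncomputable def gradedEmbedding (K : Type*) [Field K] (n : ℕ) :
    MvPowerSeries (Fin n) K →+* PowerSeries (FractionRing (MvPolynomial (Fin n) K)) :=
  (PowerSeries.map (algebraMap _ _)).comp (homogenize K n)

lemma gradedEmbedding_injective : Function.Injective (gradedEmbedding K n) := by
  intro S T hST
  refine homogenize_injective ?_
  ext1 d
  have := congrArg (PowerSeries.coeff d) hST
  rw [gradedEmbedding, RingHom.comp_apply, RingHom.comp_apply, PowerSeries.coeff_map,
    PowerSeries.coeff_map] at this
  exact IsFractionRing.injective _ _ this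

lemma gradedEmbedding_of_isHomogeneous {p : MvPolynomial (Fin n) K} {d : ℕ}
    (h : p.IsHomogeneous d) : gradedEmbedding K n p =
      PowerSeries.X ^ d * PowerSeries.C (algebraMap _ _ p) := by
  rw [gradedEmbedding, RingHom.comp_apply, isHomogeneous_iff_homogenize.mp h, map_mul, map_pow,
    PowerSeries.map_X, PowerSeries.map_C]

lemma gradedEmbedding_X (i : Fin n) :
    gradedEmbedding K n (MvPowerSeries.X i) = gradedVar (xvar K) i := by
  rw [← MvPolynomial.coe_X, gradedEmbedding_of_isHomogeneous (MvPolynomial.isHomogeneous_X K i),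
    pow_one]
  rfl

lemma gradedEmbedding_C (c : K) :
    gradedEmbedding K n (MvPowerSeries.C c) = PowerSeries.C (scal n c) := by
  rw [← MvPolynomial.coe_C, gradedEmbedding_of_isHomogeneous (MvPolynomial.isHomogeneous_C _ c),
    pow_zero, one_mul]
  rfl

lemma gradedEmbedding_sumSide {a : K} (ha : a ≠ 0) (b t : K) :
    gradedEmbedding K n (sumSide n a b t) =
      exponentSeries (scal n t) (xvar K) (rsWeight (scal n t) (scal n a) (scal n b))
        Finset.univ := by
  ext d
  rw [coeff_exponentSeries a b t ha, gradedEmbedding, RingHom.comp_apply, PowerSeries.coeff_map,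
    coeff_homogenize]
  congr 1
  ext e
  rw [coeff_degreePart, MvPolynomial.coeff_sum]
  simp only [MvPolynomial.coeff_C_mul]
  split_ifs with h
  · subst h
    rfl
  · symm
    refine Finset.sum_eq_zero fun μ hμ => ?_
    rw [(isHomogeneous_hlPoly t μ).coeff_eq_zero, mul_zero]
    rwa [mem_ptnsOf.mp hμ]

lemma xvar_injective : Function.Injective (xvar K : Fin n → _) := fun i j h => by
  by_contra hne
  exact xvar_sub_ne_zero hne (sub_eq_zero.mpr h)

lemma xvar_ne_zero (i : Fin n) : xvar K i ≠ 0 := by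
  rw [xvar, Ne, IsFractionRing.to_map_eq_zero_iff]
  exact MvPolynomial.X_ne_zero i

lemma scal_injective : Function.Injective (scal n : K → _) := fun _ _ h =>
  MvPolynomial.C_injective _ _ (IsFractionRing.injective _ _ h)

lemma scal_pow_ne_one {t : K} (ht : ∀ m : ℕ, 0 < m → t ^ m ≠ 1) (m : ℕ) (hm : 0 < m) :
    scal n t ^ m ≠ 1 := fun h => ht m hm (scal_injective (n := n) (by
  simpa [scal] using h))

lemma prod_pairs_eq_pairProd {R : Type*} [CommRing R] (g : Fin n → Fin n → R) :
    ∏ p : {p : Fin n × Fin n // p.1 < p.2}, g p.1.1 p.1.2 = pairProd g Finset.univ := by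
  rw [pairProd, ← Fintype.prod_prod_type' fun i j => if i < j then g i j else 1,
    ← Finset.prod_filter]
  exact (Finset.prod_subtype _ (by simp) fun p : Fin n × Fin n => g p.1 p.2).symm

/-- The identity in `n` variables, as an equation between power series. -/
theorem sumSide_eq {a : K} (ha : a ≠ 0) (b : K) {t : K} (ht : ∀ m : ℕ, 0 < m → t ^ m ≠ 1) :
    sumSide n a b t = (∏ i : Fin n, singleFactor a b i) *
      ∏ p : {p : Fin n × Fin n // p.1 < p.2}, pairFactor t p.1.1 p.1.2 := by
  have key : sumSide n a b t * ((∏ i : Fin n, ((1 - MvPowerSeries.X i) *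
        (1 + MvPowerSeries.X i))) *
        pairProd (fun i j => 1 - MvPowerSeries.X i * MvPowerSeries.X j) Finset.univ) =
      (∏ i : Fin n, ((1 + MvPowerSeries.C a * MvPowerSeries.X i) *
        (1 + MvPowerSeries.C b * MvPowerSeries.X i))) *
        pairProd (fun i j => 1 - MvPowerSeries.C t * MvPowerSeries.X i * MvPowerSeries.X j)
          Finset.univ := by
    apply gradedEmbedding_injective
    have h := exponentSeries_rsWeight (scal_pow_ne_one (n := n) ht) (xvar_injective (K := K))
      xvar_ne_zero (scal n a) (scal n b) Finset.univ
    rw [← gradedEmbedding_sumSide ha] at h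
    simpa only [map_mul, map_prod, map_sub, map_add, map_one, map_pairProd, gradedEmbedding_X,
      gradedEmbedding_C] using h
  have h1 : (∏ i : Fin n, singleFactor a b i) * (∏ i : Fin n, ((1 - MvPowerSeries.X i) *
      (1 + MvPowerSeries.X i))) = ∏ i : Fin n, ((1 + MvPowerSeries.C a * MvPowerSeries.X i) *
        (1 + MvPowerSeries.C b * MvPowerSeries.X i)) := by
    rw [← Finset.prod_mul_distrib]
    refine Finset.prod_congr rfl fun i _ => ?_
    rw [singleFactor, mul_assoc _ _⁻¹, MvPowerSeries.inv_mul_cancel, mul_one]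
    simp
  have h2 : (∏ p : {p : Fin n × Fin n // p.1 < p.2}, pairFactor t p.1.1 p.1.2) *
      pairProd (fun i j => 1 - MvPowerSeries.X i * MvPowerSeries.X j) Finset.univ =
      pairProd (fun i j => 1 - MvPowerSeries.C t * MvPowerSeries.X i * MvPowerSeries.X j)
          Finset.univ := by
    rw [← prod_pairs_eq_pairProd, ← prod_pairs_eq_pairProd, ← Finset.prod_mul_distrib]
    refine Finset.prod_congr rfl fun p _ => ?_
    rw [pairFactor, mul_assoc, MvPowerSeries.inv_mul_cancel, mul_one]
    simp
  have hne : (∏ i : Fin n, ((1 - MvPowerSeries.X i) * (1 + MvPowerSeries.X i))) *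
      pairProd (fun i j => 1 - MvPowerSeries.X i * MvPowerSeries.X j) Finset.univ ≠
        (0 : MvPowerSeries (Fin n) K) := by
    intro h
    have := congrArg MvPowerSeries.constantCoeff h
    simp [pairProd, apply_ite MvPowerSeries.constantCoeff] at this
  apply mul_right_cancel₀ hne
  rw [key, ← h1, ← h2]
  ring

/-- Sums over all partitions converge if the coefficient of each monomial only involves the
partitions of its degree. -/
lemma hasSum_of_degree [TopologicalSpace K] {σ : Type*} (f : Ptn → MvPowerSeries σ K)
    (g : MvPowerSeries σ K) (hf : ∀ μ e, e.degree ≠ μ.1 → MvPowerSeries.coeff e (f μ) = 0)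
    (hg : ∀ e, MvPowerSeries.coeff e g = ∑ μ ∈ ptnsOf e.degree, MvPowerSeries.coeff e (f μ)) :
    HasSum f g := by
  rw [MvPowerSeries.WithPiTopology.hasSum_iff_hasSum_coeff]
  intro e
  rw [hg e]
  refine hasSum_sum_of_ne_finset_zero fun μ hμ => hf μ e fun h => hμ (mem_ptnsOf.mpr h.symm)

end FiniteIdentity

/-! ### Infinitely many variables -/

section Restriction

variable {K : Type*} [Field K]

/-- The restriction of a power series in infinitely many variables to the first `n` of them: the
others are set equal to `0`. -/
noncomputable def restrictVars (K : Type*) [Field K] (n : ℕ) :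
    MvPowerSeries ℕ K →ₐ[K] MvPowerSeries (Fin n) K :=
  MvPowerSeries.killCompl Fin.valEmbedding

/-- A bound for the variables that occur in a monomial. -/
def varBound (e : ℕ →₀ ℕ) : ℕ := e.support.sup fun i => i + 1

/-- The restriction of a monomial to the first `n` variables. -/
noncomputable def restrictExp (n : ℕ) (e : ℕ →₀ ℕ) : Fin n →₀ ℕ :=
  e.comapDomain (fun i : Fin n => (i : ℕ)) Fin.val_injective.injOn

lemma embDomain_restrictExp {n : ℕ} {e : ℕ →₀ ℕ} (h : varBound e ≤ n) :
    (restrictExp n e).embDomain Fin.valEmbedding = e := by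
  refine Finsupp.embDomain_comapDomain (f := Fin.valEmbedding) fun i hi => ?_
  have : i + 1 ≤ varBound e := Finset.le_sup (f := fun i => i + 1) hi
  exact ⟨⟨i, by omega⟩, rfl⟩

lemma varBound_embDomain_le {n : ℕ} (e : Fin n →₀ ℕ) :
    varBound (e.embDomain Fin.valEmbedding) ≤ n := by
  refine Finset.sup_le fun i hi => ?_
  rw [Finsupp.support_embDomain, Finset.mem_map] at hi
  obtain ⟨j, -, rfl⟩ := hi
  exact j.2

lemma coeff_restrictVars {n : ℕ} (S : MvPowerSeries ℕ K) (e : Fin n →₀ ℕ) :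
    MvPowerSeries.coeff e (restrictVars K n S) =
      MvPowerSeries.coeff (e.embDomain Fin.valEmbedding) S :=
  MvPowerSeries.coeff_killCompl _ _

lemma coeff_eq_coeff_restrictVars {n : ℕ} (S : MvPowerSeries ℕ K) {e : ℕ →₀ ℕ}
    (h : varBound e ≤ n) : MvPowerSeries.coeff e S =
      MvPowerSeries.coeff (restrictExp n e) (restrictVars K n S) := by
  rw [coeff_restrictVars, embDomain_restrictExp h]

lemma degree_restrictExp {n : ℕ} {e : ℕ →₀ ℕ} (h : varBound e ≤ n) :
    (restrictExp n e).degree = e.degree := by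
  conv_rhs => rw [← embDomain_restrictExp h]
  simp only [Finsupp.degree_apply, Finsupp.support_embDomain, Finset.sum_map,
    Finsupp.embDomain_apply_self]

lemma restrictVars_X (n : ℕ) (i : Fin n) :
    restrictVars K n (MvPowerSeries.X (i : ℕ)) = MvPowerSeries.X i :=
  MvPowerSeries.killCompl_X (e := Fin.valEmbedding) i

lemma restrictVars_X_of_le {n i : ℕ} (h : n ≤ i) :
    restrictVars K n (MvPowerSeries.X i) = 0 := by
  refine MvPowerSeries.killCompl_X_eq_zero (e := Fin.valEmbedding) ?_
  rintro ⟨j, rfl⟩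
  exact absurd j.2 (not_lt.mpr h)

lemma restrictVars_C (n : ℕ) (c : K) :
    restrictVars K n (MvPowerSeries.C c) = MvPowerSeries.C c :=
  MvPowerSeries.killCompl_C c

lemma constantCoeff_restrictVars (n : ℕ) (S : MvPowerSeries ℕ K) :
    MvPowerSeries.constantCoeff (restrictVars K n S) = MvPowerSeries.constantCoeff S := by
  rw [← MvPowerSeries.coeff_zero_eq_constantCoeff_apply, coeff_restrictVars,
    Finsupp.embDomain_zero, MvPowerSeries.coeff_zero_eq_constantCoeff_apply]

lemma restrictVars_inv (n : ℕ) {S : MvPowerSeries ℕ K} (h : MvPowerSeries.constantCoeff S ≠ 0) :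
    restrictVars K n S⁻¹ = (restrictVars K n S)⁻¹ := by
  rw [MvPowerSeries.eq_inv_iff_mul_eq_one (by rwa [constantCoeff_restrictVars]), ← map_mul,
    MvPowerSeries.inv_mul_cancel _ h, map_one]

lemma restrictVars_singleFactor (a b : K) (n : ℕ) (i : Fin n) :
    restrictVars K n (singleFactor a b (i : ℕ)) = singleFactor a b i := by
  rw [singleFactor, map_mul, restrictVars_inv _ (by simp)]
  simp only [map_mul, map_add, map_sub, map_one, restrictVars_X, restrictVars_C]
  rfl

lemma restrictVars_singleFactor_of_le (a b : K) {n i : ℕ} (h : n ≤ i) :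
    restrictVars K n (singleFactor a b i) = 1 := by
  rw [singleFactor, map_mul, restrictVars_inv _ (by simp)]
  simp only [map_mul, map_add, map_sub, map_one, restrictVars_X_of_le h]
  rw [← MvPowerSeries.eq_mul_inv_iff_mul_eq] <;> simp

lemma restrictVars_pairFactor (t : K) (n : ℕ) (i j : Fin n) :
    restrictVars K n (pairFactor t (i : ℕ) (j : ℕ)) = pairFactor t i j := by
  rw [pairFactor, map_mul, restrictVars_inv _ (by simp)]
  simp only [map_mul, map_sub, map_one, restrictVars_X, restrictVars_C]
  rfl

lemma restrictVars_pairFactor_of_le (t : K) {n j : ℕ} (i : ℕ) (h : n ≤ j) :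
    restrictVars K n (pairFactor t i j) = 1 := by
  rw [pairFactor, map_mul, restrictVars_inv _ (by simp)]
  simp only [map_mul, map_sub, map_one, restrictVars_X_of_le h]
  rw [← MvPowerSeries.eq_mul_inv_iff_mul_eq] <;> simp

/-- A family of power series such that, for each `n`, the members outside the finite set `A n`
restrict to `1` in the first `n` variables, is multipliable, and the product can be computed after
restriction. -/
lemma exists_hasProd_of_restrictVars [TopologicalSpace K] {I : Type*} (f : I → MvPowerSeries ℕ K)
    (A : ℕ → Finset I) (hA : Monotone A) (h : ∀ n, ∀ i ∉ A n, restrictVars K n (f i) = 1) :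
    ∃ g, HasProd f g ∧ ∀ n, restrictVars K n g = ∏ i ∈ A n, restrictVars K n (f i) := by
  have key : ∀ (e : ℕ →₀ ℕ) (s : Finset I), A (varBound e) ⊆ s →
      MvPowerSeries.coeff e (∏ i ∈ s, f i) =
        MvPowerSeries.coeff e (∏ i ∈ A (varBound e), f i) := by
    intro e s hs
    rw [coeff_eq_coeff_restrictVars _ le_rfl, coeff_eq_coeff_restrictVars (∏ i ∈ A _, f i) le_rfl,
      map_prod (restrictVars K _), map_prod (restrictVars K _),
      Finset.prod_subset hs fun i _ hi => h _ i hi]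
  let g : MvPowerSeries ℕ K := fun e => MvPowerSeries.coeff e (∏ i ∈ A (varBound e), f i)
  refine ⟨g, ?_, fun n => ?_⟩
  · refine (MvPowerSeries.WithPiTopology.tendsto_iff_coeff_tendsto _ _ _).mpr fun e => ?_
    rw [SummationFilter.unconditional_filter]
    refine tendsto_const_nhds.congr' ?_
    filter_upwards [Filter.eventually_ge_atTop (A (varBound e))] with s hs
    exact (key e s hs).symm
  · ext e
    rw [coeff_restrictVars, ← map_prod, coeff_restrictVars]
    exact (key _ _ (hA (varBound_embDomain_le e))).symm

/-- The pairs of indices below `n`. -/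
def pairsBelow (n : ℕ) : Finset {p : ℕ × ℕ // p.1 < p.2} :=
  Finset.univ.map ⟨fun p : {p : Fin n × Fin n // p.1 < p.2} =>
    (⟨(p.1.1, p.1.2), p.2⟩ : {p : ℕ × ℕ // p.1 < p.2}), fun p q h => by
      simp only [Subtype.mk.injEq, Prod.mk.injEq] at h
      exact Subtype.ext (Prod.ext (Fin.ext h.1) (Fin.ext h.2))⟩

lemma mem_pairsBelow {n : ℕ} {p : {p : ℕ × ℕ // p.1 < p.2}} : p ∈ pairsBelow n ↔ p.1.2 < n := by
  simp only [pairsBelow, Finset.mem_map, Finset.mem_univ, true_and]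
  constructor
  · rintro ⟨q, rfl⟩
    exact q.1.2.2
  · intro h
    exact ⟨⟨(⟨p.1.1, p.2.trans h⟩, ⟨p.1.2, h⟩), p.2⟩, rfl⟩

end Restriction

end HallLittlewood

/-- The identity holds in `n` variables for every `n`, and in infinitely many variables. Sums and
products of power series converge coefficientwise: `K` is discrete, and power series carry the
product topology. For the identity with indeterminate parameters take `K = ℚ(a, b, t)`. -/
theorem theorem1p1 {K : Type*} [Field K] [TopologicalSpace K] [DiscreteTopology K]
    (a b t : K) (ha : a ≠ 0) (ht : ∀ m : ℕ, 0 < m → t ^ m ≠ 1) :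
    (∀ n : ℕ,
      HasSum
        (fun μ : HallLittlewood.Ptn =>
          (a ^ HallLittlewood.len (HallLittlewood.oddPart μ) *
            HallLittlewood.hPtn (HallLittlewood.evenPart μ) (a * b) t *
            HallLittlewood.hPtn (HallLittlewood.oddPart μ) (b / a) t) •
          (HallLittlewood.hlPoly n t μ : MvPowerSeries (Fin n) K))
        ((∏ i : Fin n, HallLittlewood.singleFactor a b i) *
          ∏ p : {p : Fin n × Fin n // p.1 < p.2},
            HallLittlewood.pairFactor t p.1.1 p.1.2)) ∧
    Multipliable (fun i : ℕ => HallLittlewood.singleFactor a b i) ∧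
    Multipliable (fun p : {p : ℕ × ℕ // p.1 < p.2} =>
      HallLittlewood.pairFactor t p.1.1 p.1.2) ∧
    HasSum
      (fun μ : HallLittlewood.Ptn =>
        (a ^ HallLittlewood.len (HallLittlewood.oddPart μ) *
          HallLittlewood.hPtn (HallLittlewood.evenPart μ) (a * b) t *
          HallLittlewood.hPtn (HallLittlewood.oddPart μ) (b / a) t) •
        HallLittlewood.hlFun t μ)
      ((∏' i : ℕ, HallLittlewood.singleFactor a b i) *
        ∏' p : {p : ℕ × ℕ // p.1 < p.2}, HallLittlewood.pairFactor t p.1.1 p.1.2) := by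
  open HallLittlewood in
  obtain ⟨g₁, hg₁, hr₁⟩ := exists_hasProd_of_restrictVars (fun i : ℕ => singleFactor a b i)
    Finset.range Finset.range_mono
    (fun n i hi => restrictVars_singleFactor_of_le a b (not_lt.mp fun h =>
      hi (Finset.mem_range.mpr h)))
  obtain ⟨g₂, hg₂, hr₂⟩ := exists_hasProd_of_restrictVars
    (fun p : {p : ℕ × ℕ // p.1 < p.2} => pairFactor t p.1.1 p.1.2) pairsBelow
    (fun m n hmn p hp => mem_pairsBelow.mpr ((mem_pairsBelow.mp hp).trans_le hmn))
    (fun n p hp => restrictVars_pairFactor_of_le t p.1.1 (not_lt.mp fun h =>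
      hp (mem_pairsBelow.mpr h)))
  refine ⟨fun n => ?_, hg₁.multipliable, hg₂.multipliable, ?_⟩
  · refine hasSum_of_degree _ _ (fun μ e he => ?_) fun e => ?_
    · rw [MvPowerSeries.coeff_smul, MvPolynomial.coeff_coe,
        (isHomogeneous_hlPoly t μ).coeff_eq_zero he, mul_zero]
    · rw [← sumSide_eq ha b ht]
      change ∑ μ ∈ ptnsOf e.degree, _ = _
      exact Finset.sum_congr rfl fun μ _ => by
        rw [MvPowerSeries.coeff_smul, MvPolynomial.coeff_coe, ptnCoeff]
  · rw [hg₁.tprod_eq, hg₂.tprod_eq]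
    have hc : ∀ μ e, MvPowerSeries.coeff e (hlFun t μ) =
        (hlPoly (varBound e) t μ).coeff (restrictExp (varBound e) e) := fun _ _ => rfl
    refine hasSum_of_degree _ _ (fun μ e he => ?_) fun e => ?_
    · rw [MvPowerSeries.coeff_smul, hc, (isHomogeneous_hlPoly t μ).coeff_eq_zero, mul_zero]
      rwa [degree_restrictExp le_rfl]
    · have h₁ : restrictVars K (varBound e) g₁ = ∏ i : Fin (varBound e), singleFactor a b i := by
        rw [hr₁, Finset.prod_range]
        exact Finset.prod_congr rfl fun i _ => restrictVars_singleFactor a b _ i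
      have h₂ : restrictVars K (varBound e) g₂ =
          ∏ p : {p : Fin (varBound e) × Fin (varBound e) // p.1 < p.2},
            pairFactor t p.1.1 p.1.2 := by
        rw [hr₂, pairsBelow, Finset.prod_map]
        exact Finset.prod_congr rfl fun p _ => restrictVars_pairFactor t _ p.1.1 p.1.2
      rw [coeff_eq_coeff_restrictVars _ le_rfl, map_mul, h₁, h₂, ← sumSide_eq ha b ht]
      change ∑ μ ∈ ptnsOf (restrictExp (varBound e) e).degree, _ = _
      rw [degree_restrictExp le_rfl]
      exact Finset.sum_congr rfl fun μ _ => by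
        rw [MvPowerSeries.coeff_smul, hc, ptnCoeff]
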